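/- Let $\Bbbk$ be an algebraically closed field of characteristic zero, let $n=3$ or $n=4$, and let $X\subset\mathbb S_n$ be the set of transpositions. Let $\Bbbk^{\mathbb S_n}$ be the Hopf algebra of functions on $\mathbb S_n$, with basis $\{\delta_\omega\}_{\omega\in\mathbb S_n}$, and let $V$ be the Yetter–Drinfeld module over $\Bbbk^{\mathbb S_n}$ with basis $\{y_\eta\}_{\eta\in X}$, action and coaction $$\delta_\tau\cdot y_\eta=\delta_{\tau,\eta}\,y_\eta,\qquad y_\eta\mapsto\sum_{\omega\in\mathbb S_n}\operatorname{sign}(\omega)\,\delta_\omega\otimes y_{\omega^{-1}\eta\omega}\qquad(\tau\in\mathbb S_n,\ \eta\in X).$$ Let $\mathcal{FK}_n=\mathfrak B(V)$ be its Nichols algebra and $\mathcal{FK}_n\#\Bbbk^{\mathbb S_n}$ the bosonization. Let $V^*$ be the Yetter–Drinfeld module over $\Bbbk\mathbb S_n$ with basis $\{x_\eta\}_{\eta\in X}$, action $\tau\cdot x_\eta=\operatorname{sign}(\tau)\,x_{\tau\eta\tau^{-1}}$ and coaction $x_\eta\mapsto\eta\otimes x_\eta$, and let $\mathfrak B(V^*)\#\Bbbk\mathbb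 S_n$ be the bosonization of its Nichols algebra. Put $$J_n=1\otimes 1+\sum_{\omega\in\mathbb S_n}\operatorname{sign}(\omega)\sum_{\eta,\tau\in X}y_\eta\,\delta_\omega\otimes y_{\omega^{-1}\tau\omega}\ \in\ (\mathcal{FK}_n\#\Bbbk^{\mathbb S_n})^{\otimes 2}.$$ 1. $J_n$ is a twist for $\mathcal{FK}_n\#\Bbbk^{\mathbb S_n}$, that is, $J_n$ is invertible and $$(1\otimes J_n)(\operatorname{id}\otimes\Delta)(J_n)=(J_n\otimes 1)(\Delta\otimes\operatorname{id})(J_n),\qquad(\operatorname{id}\otimes\epsilon)(J_n)=(\epsilon\otimes\operatorname{id})(J_n)=1.$$ 2. There is exactly one bilinear form $\sigma$ on $\mathfrak B(V^*)\#\Bbbk\mathbb S_n$ (the García–Mastnak cocycle) such that $$\sigma(x_\tau\omega,x_{\tau'}\omega')=\operatorname{sign}(\omega),\qquad\sigma(\omega,\omega')=1\qquad(\tau,\tau'\in X,\ \omega,\omega'\in\mathbb S_n)$$ and $\sigma$ vanishes on $(\mathfrak B^i(V^*)\#\Bbbk\mathbb S_n)\times(\mathfrak B^j(V^*)\#\Bbbk\mathbb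 S_n)$ whenever $(i,j)\neq(0,0),(1,1)$. It is a Hopf 2-cocycle: it is convolution invertible, and for all $x,y,z$ $$\sigma(x_{(1)},y_{(1)})\,\sigma(x_{(2)}y_{(2)},z)=\sigma(y_{(1)},z_{(1)})\,\sigma(x,y_{(2)}z_{(2)}),\qquad\sigma(x,1)=\sigma(1,x)=\epsilon(x).$$ 3. $J_n$ is the transpose of $\sigma$. That is, there is exactly one Hopf pairing $\langle\ ,\ \rangle$ between $\mathcal{FK}_n\#\Bbbk^{\mathbb S_n}$ and $\mathfrak B(V^*)\#\Bbbk\mathbb S_n$ with $$\langle\delta_\omega,g\rangle=\delta_{\omega,g},\qquad\langle y_\eta,x_\tau\rangle=\delta_{\eta,\tau},\qquad\langle\delta_\omega,x_\tau\rangle=\langle y_\eta,g\rangle=0\qquad(\omega,g\in\mathbb S_n,\ \eta,\tau\in X),$$ it is non-degenerate on both sides, and $\sigma(x,x')=\langle J_n,x\otimes x'\rangle$ for all $x,x'\in\mathfrak B(V^*)\#\Bbbk\mathbb S_n$. Here a Hopf pairing is a bilinear pairing with $\langle ab,x\rangle=\langle a,x_{(1)}\rangle\langle b,x_{(2)}\rangle$,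 $\langle a,xy\rangle=\langle a_{(1)},x\rangle\langle a_{(2)},y\rangle$, $\langle 1,x\rangle=\epsilon(x)$, $\langle a,1\rangle=\epsilon(a)$, extended to tensor squares by $\langle a\otimes b,x\otimes y\rangle=\langle a,x\rangle\langle b,y\rangle$. -/

import Mathlib

open scoped TensorProduct

namespace FKTwist

universe u v w

noncomputable section

/-- A left-left Yetter-Drinfeld module over the Hopf algebra `H`, on the vector space `V`. -/
structure YDModule (k : Type u) (H : Type v) (V : Type w) [Field k] [Ring H] [HopfAlgebra k H]
    [AddCommGroup V] [Module k V] where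
  /-- the action `h · v` -/
  act : H →ₐ[k] Module.End k V
  /-- the coaction `v ↦ v₍₋₁₎ ⊗ v₍₀₎` -/
  coact : V →ₗ[k] H ⊗[k] V
  counit_coact : ∀ v, TensorProduct.lid k V ((Coalgebra.counit (R := k)).rTensor V (coact v)) = v
  coassoc : ∀ v, TensorProduct.assoc k H H V ((Coalgebra.comul (R := k)).rTensor V (coact v)) =
    coact.lTensor H (coact v)
  /-- `h₍₁₎ v₍₋₁₎ ⊗ h₍₂₎ · v₍₀₎ = (h₍₁₎ · v)₍₋₁₎ h₍₂₎ ⊗ (h₍₁₎ · v)₍₀₎` -/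
  compat : ∀ h v,
    TensorProduct.map (LinearMap.mul' k H) (TensorProduct.lift act.toLinearMap)
        (TensorProduct.tensorTensorTensorComm k H H H V (Coalgebra.comul (R := k) h ⊗ₜ[k] coact v)) =
      (LinearMap.mul' k H).rTensor V (TensorProduct.rightComm k H V H
        (TensorProduct.map (coact ∘ₗ act.toLinearMap.flip v) LinearMap.id
          (Coalgebra.comul (R := k) h)))

namespace YDModule

variable {k : Type u} {H : Type v} {V : Type w} [Field k] [Ring H] [HopfAlgebra k H]
    [AddCommGroup V] [Module k V] (M : YDModule k H V)

/-- The defining relations of `T(V) # H`: those of the algebra `H`, and `h v = (h₍₁₎ · v) h₍₂₎`. -/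
inductive Rel : TensorAlgebra k (H × V) → TensorAlgebra k (H × V) → Prop
  | one : Rel (TensorAlgebra.ι k (1, 0)) 1
  | mul (a b : H) : Rel (TensorAlgebra.ι k (a * b, 0))
      (TensorAlgebra.ι k (a, 0) * TensorAlgebra.ι k (b, 0))
  | cross (h : H) (v : V) : Rel (TensorAlgebra.ι k (h, 0) * TensorAlgebra.ι k (0, v))
      (LinearMap.mul' k _ (TensorProduct.map
        (TensorAlgebra.ι k ∘ₗ LinearMap.inr k H V ∘ₗ M.act.toLinearMap.flip v)
        (TensorAlgebra.ι k ∘ₗ LinearMap.inl k H V) (Coalgebra.comul (R := k) h)))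

/-- The bosonization `T(V) # H` of the tensor algebra of `V`: the algebra generated by the vector
space `V` and the algebra `H` subject to `h v = (h₍₁₎ · v) h₍₂₎`. -/
def TensorBosonization : Type (max u v w) := RingQuot M.Rel

instance : Ring M.TensorBosonization := inferInstanceAs (Ring (RingQuot M.Rel))
instance : Algebra k M.TensorBosonization := inferInstanceAs (Algebra k (RingQuot M.Rel))

namespace TensorBosonization

/-- The quotient map from the free algebra on `H × V`. -/
def mk : TensorAlgebra k (H × V) →ₐ[k] M.TensorBosonization := RingQuot.mkAlgHom k M.Rel

variable {M} in
theorem mk_rel {x y : TensorAlgebra k (H × V)} (h : M.Rel x y) : mk M x = mk M y :=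
  RingQuot.mkAlgHom_rel k h

theorem mk_surjective : Function.Surjective (mk M) := RingQuot.mkAlgHom_surjective k M.Rel

/-- The inclusion of `H` in `T(V) # H`. -/
def ιH : H →ₐ[k] M.TensorBosonization :=
  AlgHom.ofLinearMap ((mk M).toLinearMap ∘ₗ TensorAlgebra.ι k ∘ₗ LinearMap.inl k H V)
    (by simpa using mk_rel (Rel.one (M := M)))
    (fun a b => by simpa using mk_rel (Rel.mul (M := M) a b))

/-- The inclusion of `V` in `T(V) # H`. -/
def ιV : V →ₗ[k] M.TensorBosonization :=
  (mk M).toLinearMap ∘ₗ TensorAlgebra.ι k ∘ₗ LinearMap.inr k H V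

theorem cross (h : H) (v : V) : ιH M h * ιV M v =
    LinearMap.mul' k _ (TensorProduct.map (ιV M ∘ₗ M.act.toLinearMap.flip v) (ιH M).toLinearMap
      (Coalgebra.comul (R := k) h)) := by
  have := mk_rel (Rel.cross (M := M) h v)
  rw [map_mul] at this
  refine this.trans ?_
  rw [← (Coalgebra.Repr.arbitrary k h).eq]
  simp [map_sum, ιH, ιV]

section Lift

variable {B : Type*} [Semiring B] [Algebra k B]

/-- The universal property of `T(V) # H`. -/
def lift (f : H →ₐ[k] B) (g : V →ₗ[k] B)
    (hfg : ∀ h v, f h * g v = LinearMap.mul' k B (TensorProduct.map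
      (g ∘ₗ M.act.toLinearMap.flip v) f.toLinearMap (Coalgebra.comul (R := k) h))) :
    M.TensorBosonization →ₐ[k] B :=
  RingQuot.liftAlgHom k ⟨TensorAlgebra.lift k (f.toLinearMap.coprod g), by
    intro x y r
    cases r with
    | one => simp
    | mul a b => simp
    | cross h v =>
      rw [map_mul]
      simp only [TensorAlgebra.lift_ι_apply, LinearMap.coprod_apply, map_zero, add_zero, zero_add]
      refine (hfg h v).trans ?_
      rw [← (Coalgebra.Repr.arbitrary k h).eq]
      simp [map_sum]⟩

variable (f : H →ₐ[k] B) (g : V →ₗ[k] B) (hfg : ∀ h v, f h * g v =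
  LinearMap.mul' k B (TensorProduct.map
      (g ∘ₗ M.act.toLinearMap.flip v) f.toLinearMap (Coalgebra.comul (R := k) h)))

theorem lift_mk (x : TensorAlgebra k (H × V)) :
    lift M f g hfg (mk M x) = TensorAlgebra.lift k (f.toLinearMap.coprod g) x :=
  RingQuot.liftAlgHom_mkAlgHom_apply ..

@[simp] theorem lift_ιH (h : H) : lift M f g hfg (ιH M h) = f h := by
  simp [lift_mk, ιH]

@[simp] theorem lift_ιV (v : V) : lift M f g hfg (ιV M v) = g v := by
  simp [lift_mk, ιV]

variable {M} in
@[ext] theorem hom_ext {φ ψ : M.TensorBosonization →ₐ[k] B}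
    (hH : φ.comp (ιH M) = ψ.comp (ιH M)) (hV : φ.toLinearMap ∘ₗ ιV M = ψ.toLinearMap ∘ₗ ιV M) :
    φ = ψ := by
  refine RingQuot.ringQuot_ext' (S := k) _ _ (TensorAlgebra.hom_ext (LinearMap.prod_ext ?_ ?_))
  · ext h; exact DFunLike.congr_fun hH h
  · ext v; exact LinearMap.congr_fun hV v

end Lift

/-- The generators generate. -/
theorem induction {C : M.TensorBosonization → Prop} (hH : ∀ h, C (ιH M h)) (hV : ∀ v, C (ιV M v))
    (hmul : ∀ a b, C a → C b → C (a * b)) (hadd : ∀ a b, C a → C b → C (a + b)) (a) : C a := by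
  obtain ⟨a, rfl⟩ := mk_surjective M a
  induction a using TensorAlgebra.induction with
  | algebraMap r =>
    have := hH (algebraMap k H r)
    rw [AlgHom.commutes] at this ⊢
    exact this
  | ι x =>
    have h : (TensorAlgebra.ι k x) = TensorAlgebra.ι k (x.1, (0 : V)) + TensorAlgebra.ι k ((0 : H), x.2) := by
      rw [← map_add]; simp
    rw [h, map_add]
    exact hadd _ _ (hH x.1) (hV x.2)
  | mul a b ha hb => rw [map_mul]; exact hmul _ _ ha hb
  | add a b ha hb => rw [map_add]; exact hadd _ _ ha hb



open Coalgebra in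
/-- Coassociativity in Sweedler form. -/
theorem sweedler {N : Type*} [AddCommMonoid N] [Module k N] (Φ : H ⊗[k] (H ⊗[k] H) →ₗ[k] N) (h : H) :
    ∑ i ∈ (ℛ k h).index, ∑ j ∈ (ℛ k ((ℛ k h).left i)).index,
      Φ ((ℛ k ((ℛ k h).left i)).left j ⊗ₜ[k] ((ℛ k ((ℛ k h).left i)).right j ⊗ₜ[k]
        (ℛ k h).right i)) =
    ∑ i ∈ (ℛ k h).index, ∑ j ∈ (ℛ k ((ℛ k h).right i)).index,
      Φ ((ℛ k h).left i ⊗ₜ[k] ((ℛ k ((ℛ k h).right i)).left j ⊗ₜ[k]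
        (ℛ k ((ℛ k h).right i)).right j)) := by
  simpa only [map_sum] using congrArg Φ (sum_tmul_tmul_eq (ℛ k h) (fun i => ℛ k _) (fun i => ℛ k _))

open Coalgebra in
theorem cross' (h : H) (v : V) : ιH M h * ιV M v =
    ∑ i ∈ (ℛ k h).index, ιV M (M.act ((ℛ k h).left i) v) * ιH M ((ℛ k h).right i) := by
  rw [cross]
  conv_lhs => rw [← (ℛ k h).eq]
  simp [map_sum]

open Coalgebra in
theorem compat' (h : H) (v : V) (S : Finset (H × V)) (hS : M.coact v = ∑ s ∈ S, s.1 ⊗ₜ[k] s.2) :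
    ∑ i ∈ (ℛ k h).index, ∑ s ∈ S,
      ιH M ((ℛ k h).left i * s.1) ⊗ₜ[k] ιV M (M.act ((ℛ k h).right i) s.2) =
    ∑ i ∈ (ℛ k h).index,
      TensorProduct.map (ιH M).toLinearMap (ιV M) (M.coact (M.act ((ℛ k h).left i) v)) *
        (ιH M ((ℛ k h).right i) ⊗ₜ[k] 1) := by
  have Y := congrArg (TensorProduct.map (ιH M).toLinearMap (ιV M)) (M.compat h v)
  rw [hS, ← (ℛ k h).eq] at Y
  have L : ∀ (x : H ⊗[k] V) (b : H), TensorProduct.map (ιH M).toLinearMap (ιV M)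
      ((LinearMap.mul' k H).rTensor V (TensorProduct.rightComm k H V H (x ⊗ₜ[k] b))) =
      TensorProduct.map (ιH M).toLinearMap (ιV M) x * (ιH M b ⊗ₜ[k] 1) := by
    intro x b
    induction x using TensorProduct.induction_on with
    | zero => simp
    | tmul x y => simp
    | add x y hx hy => simp only [TensorProduct.add_tmul, map_add, hx, hy, add_mul]
  simp only [map_sum, TensorProduct.map_tmul, L, LinearMap.id_coe, id_eq, LinearMap.comp_apply,
    LinearMap.flip_apply, TensorProduct.sum_tmul, TensorProduct.tmul_sum,
    TensorProduct.tensorTensorTensorComm_tmul, LinearMap.mul'_apply, TensorProduct.lift.tmul,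
    AlgHom.toLinearMap_apply] at Y
  rw [← Y, Finset.sum_comm]

open Coalgebra in
theorem comul_cross (h : H) (v : V) :
    ((Algebra.TensorProduct.map (ιH M) (ιH M)).comp (Bialgebra.comulAlgHom k H)) h *
      ((TensorProduct.mk k M.TensorBosonization M.TensorBosonization).flip 1 ∘ₗ ιV M +
        TensorProduct.map (ιH M).toLinearMap (ιV M) ∘ₗ M.coact) v =
    LinearMap.mul' k (M.TensorBosonization ⊗[k] M.TensorBosonization) (TensorProduct.map
      (((TensorProduct.mk k M.TensorBosonization M.TensorBosonization).flip 1 ∘ₗ ιV M +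
        TensorProduct.map (ιH M).toLinearMap (ιV M) ∘ₗ M.coact) ∘ₗ M.act.toLinearMap.flip v)
      ((Algebra.TensorProduct.map (ιH M) (ιH M)).comp (Bialgebra.comulAlgHom k H)).toLinearMap
      (Coalgebra.comul (R := k) h)) := by
  obtain ⟨S, hS⟩ := TensorProduct.exists_finset (M.coact v)
  let T := M.TensorBosonization
  have A1 := sweedler ((LinearMap.mul' k T).rTensor T ∘ₗ (TensorProduct.assoc k T T T).symm.toLinearMap
    ∘ₗ TensorProduct.map (ιV M ∘ₗ M.act.toLinearMap.flip v)
      (TensorProduct.map (ιH M).toLinearMap (ιH M).toLinearMap)) h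
  have A2 := sweedler (LinearMap.mul' k (T ⊗[k] T) ∘ₗ TensorProduct.map
      (TensorProduct.map (ιH M).toLinearMap (ιV M) ∘ₗ M.coact ∘ₗ M.act.toLinearMap.flip v)
      (TensorProduct.map (ιH M).toLinearMap (ιH M).toLinearMap)) h
  have A3 := fun s : H × V => sweedler ((LinearMap.mul' k T).lTensor T ∘ₗ
    TensorProduct.map ((ιH M).toLinearMap ∘ₗ LinearMap.mulRight k s.1)
      (TensorProduct.map (ιV M ∘ₗ M.act.toLinearMap.flip s.2) (ιH M).toLinearMap)) h
  simp only [LinearMap.comp_apply, TensorProduct.map_tmul, LinearMap.flip_apply, LinearEquiv.coe_coe,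
    TensorProduct.assoc_symm_tmul, LinearMap.rTensor_tmul, LinearMap.lTensor_tmul,
    LinearMap.mul'_apply, AlgHom.toLinearMap_apply, LinearMap.mulRight_apply] at A1 A2 A3
  have key : ∀ i, ∑ j ∈ (ℛ k ((ℛ k h).left i)).index,
      TensorProduct.map (ιH M).toLinearMap (ιV M)
          (M.coact (M.act ((ℛ k ((ℛ k h).left i)).left j) v)) *
        (ιH M ((ℛ k ((ℛ k h).left i)).right j) ⊗ₜ[k] ιH M ((ℛ k h).right i)) =
      ∑ j ∈ (ℛ k ((ℛ k h).left i)).index, ∑ s ∈ S,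
        ιH M ((ℛ k ((ℛ k h).left i)).left j * s.1) ⊗ₜ[k]
          (ιV M (M.act ((ℛ k ((ℛ k h).left i)).right j) s.2) * ιH M ((ℛ k h).right i)) := by
    intro i
    have := congrArg (· * ((1 : T) ⊗ₜ[k] ιH M ((ℛ k h).right i))) (compat' M ((ℛ k h).left i) v S hS)
    simpa only [Finset.sum_mul, mul_assoc, Algebra.TensorProduct.tmul_mul_tmul, one_mul, mul_one]
      using this.symm
  have R : ∀ x : H, Coalgebra.comul (R := k) x =
    ∑ i ∈ (ℛ k x).index, (ℛ k x).left i ⊗ₜ[k] (ℛ k x).right i := fun x => (ℛ k x).eq.symm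
  conv_rhs => rw [R h]
  simp only [map_sum, TensorProduct.map_tmul, LinearMap.mul'_apply, LinearMap.comp_apply,
    LinearMap.add_apply, add_mul, LinearMap.flip_apply, AlgHom.toLinearMap_apply,
    TensorProduct.mk_apply, AlgHom.comp_apply, Bialgebra.comulAlgHom_apply, R,
    Algebra.TensorProduct.map_tmul, Finset.sum_add_distrib, mul_add, Finset.mul_sum,
    Algebra.TensorProduct.tmul_mul_tmul, one_mul]
  rw [← A1, ← A2]
  congr 1
  · rw [Finset.sum_mul]
    refine Finset.sum_congr rfl fun i _ => ?_
    rw [Algebra.TensorProduct.tmul_mul_tmul, mul_one, cross', TensorProduct.sum_tmul]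
  · simp only [key]
    rw [hS]
    simp only [map_sum, TensorProduct.map_tmul, AlgHom.toLinearMap_apply, Finset.mul_sum,
      Finset.sum_mul, Algebra.TensorProduct.tmul_mul_tmul, cross', TensorProduct.tmul_sum,
      ← map_mul]
    have B3 := Finset.sum_congr (rfl : S = S) (fun s _ => (A3 s).symm)
    rw [Finset.sum_comm]
    refine (Eq.trans ?_ B3).trans ?_
    · rw [Finset.sum_comm]
    · rw [Finset.sum_comm]
      exact Finset.sum_congr rfl fun i _ => Finset.sum_comm

/-- The comultiplication of `T(V) # H`: that of `H`, and `Δ(v) = v ⊗ 1 + v₍₋₁₎ ⊗ v₍₀₎`. -/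
def comulHom : M.TensorBosonization →ₐ[k] M.TensorBosonization ⊗[k] M.TensorBosonization :=
  lift M ((Algebra.TensorProduct.map (ιH M) (ιH M)).comp (Bialgebra.comulAlgHom k H))
    ((TensorProduct.mk k M.TensorBosonization M.TensorBosonization).flip 1 ∘ₗ ιV M +
      TensorProduct.map (ιH M).toLinearMap (ιV M) ∘ₗ M.coact) (comul_cross M)

/-- The counit of `T(V) # H`: that of `H`, and `ε(v) = 0`. -/
def counitHom : M.TensorBosonization →ₐ[k] k :=
  lift M (Bialgebra.counitAlgHom k H) 0 (by
    intro h v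
    rw [← (Coalgebra.Repr.arbitrary k h).eq]
    simp)

@[simp] theorem comulHom_ιH (h : H) : comulHom M (ιH M h) =
    TensorProduct.map (ιH M).toLinearMap (ιH M).toLinearMap (Coalgebra.comul (R := k) h) := by
  simp only [comulHom, lift_ιH]
  rfl

@[simp] theorem comulHom_ιV (v : V) : comulHom M (ιV M v) =
    ιV M v ⊗ₜ[k] 1 + TensorProduct.map (ιH M).toLinearMap (ιV M) (M.coact v) := by
  simp [comulHom]

@[simp] theorem counitHom_ιH (h : H) : counitHom M (ιH M h) = Coalgebra.counit (R := k) h := by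
  simp [counitHom]

@[simp] theorem counitHom_ιV (v : V) : counitHom M (ιV M v) = 0 := by
  simp [counitHom]

open Coalgebra in
instance : Bialgebra k M.TensorBosonization :=
  Bialgebra.ofAlgHom (comulHom M) (counitHom M)
    (by
      refine hom_ext (AlgHom.ext fun h => ?_) (LinearMap.ext fun v => ?_)
      · have A := sweedler (TensorProduct.map (ιH M).toLinearMap
          (TensorProduct.map (ιH M).toLinearMap (ιH M).toLinearMap)) h
        have R : ∀ x : H, Coalgebra.comul (R := k) x =
          ∑ i ∈ (ℛ k x).index, (ℛ k x).left i ⊗ₜ[k] (ℛ k x).right i := fun x => (ℛ k x).eq.symm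
        simp only [TensorProduct.map_tmul, AlgHom.toLinearMap_apply] at A
        simp [R, TensorProduct.sum_tmul, TensorProduct.tmul_sum]
        exact A
      · obtain ⟨S, hS⟩ := TensorProduct.exists_finset (M.coact v)
        have L : ∀ (x : H ⊗[k] H) (w : V), TensorProduct.map (ιH M).toLinearMap
            (TensorProduct.map (ιH M).toLinearMap (ιV M))
              (TensorProduct.assoc k H H V (x ⊗ₜ[k] w)) =
            TensorProduct.assoc k M.TensorBosonization M.TensorBosonization M.TensorBosonization
              (TensorProduct.map (ιH M).toLinearMap (ιH M).toLinearMap x ⊗ₜ[k] ιV M w) := by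
          intro x w
          induction x using TensorProduct.induction_on with
          | zero => simp
          | tmul x y => simp
          | add x y hx hy => simp only [TensorProduct.add_tmul, map_add, hx, hy]
        have A := congrArg (TensorProduct.map (ιH M).toLinearMap
          (TensorProduct.map (ιH M).toLinearMap (ιV M))) (M.coassoc v)
        simp only [hS, map_sum, LinearMap.rTensor_tmul, L, LinearMap.lTensor_tmul,
          TensorProduct.map_tmul, AlgHom.toLinearMap_apply] at A
        simp [hS, TensorProduct.sum_tmul, TensorProduct.tmul_sum, TensorProduct.add_tmul,
          TensorProduct.tmul_add, Finset.sum_add_distrib, Algebra.TensorProduct.one_def, add_assoc]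
        exact A)
    (by
      refine hom_ext (AlgHom.ext fun h => ?_) (LinearMap.ext fun v => ?_)
      · have A := congrArg ((ιH M).toLinearMap.lTensor k) (rTensor_counit_comul (R := k) h)
        rw [← (ℛ k h).eq] at A
        simp at A ⊢
        rw [← (ℛ k h).eq]
        simp
      · have A := congrArg (ιV M) (M.counit_coact v)
        obtain ⟨S, hS⟩ := TensorProduct.exists_finset (M.coact v)
        simp [hS] at A ⊢
        simp only [← A, TensorProduct.tmul_sum, TensorProduct.tmul_smul, TensorProduct.smul_tmul']
        simp)
    (by
      refine hom_ext (AlgHom.ext fun h => ?_) (LinearMap.ext fun v => ?_)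
      · have A := congrArg ((ιH M).toLinearMap.rTensor k) (lTensor_counit_comul (R := k) h)
        rw [← (ℛ k h).eq] at A
        simp at A ⊢
        rw [← (ℛ k h).eq]
        simp
      · obtain ⟨S, hS⟩ := TensorProduct.exists_finset (M.coact v)
        simp [hS])

@[simp] theorem comul_ιH (h : H) : Coalgebra.comul (R := k) (ιH M h) =
    TensorProduct.map (ιH M).toLinearMap (ιH M).toLinearMap (Coalgebra.comul (R := k) h) :=
  comulHom_ιH M h

@[simp] theorem comul_ιV (v : V) : Coalgebra.comul (R := k) (ιV M v) =
    ιV M v ⊗ₜ[k] 1 + TensorProduct.map (ιH M).toLinearMap (ιV M) (M.coact v) :=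
  comulHom_ιV M v

@[simp] theorem counit_ιH (h : H) :
    Coalgebra.counit (R := k) (ιH M h) = Coalgebra.counit (R := k) h := counitHom_ιH M h

@[simp] theorem counit_ιV (v : V) : Coalgebra.counit (R := k) (ιV M v) = 0 := counitHom_ιV M v

open Coalgebra in
theorem sum_counit_smul_right (h : H) :
    ∑ i ∈ (ℛ k h).index, counit (R := k) ((ℛ k h).right i) • (ℛ k h).left i = h := by
  have := congrArg (TensorProduct.rid k H) (sum_tmul_counit_eq (ℛ k h))
  simpa only [map_sum, TensorProduct.rid_tmul, one_smul] using this

open Coalgebra WithConv in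
/-- `S(h₍₁₎) (h₍₂₎ · v) = v S(h)`. -/
theorem antipode_cross (h : H) (v : V) :
    ∑ i ∈ (ℛ k h).index, ιH M (HopfAlgebra.antipode k ((ℛ k h).left i)) *
      ιV M (M.act ((ℛ k h).right i) v) = ιV M v * ιH M (HopfAlgebra.antipode k h) := by
  let T := M.TensorBosonization
  let I : WithConv (H →ₗ[k] T) := toConv (ιH M).toLinearMap
  let P : WithConv (H →ₗ[k] T) := toConv ((ιH M).toLinearMap ∘ₗ HopfAlgebra.antipode k)
  let Q : WithConv (H →ₗ[k] T) := toConv (ιV M ∘ₗ M.act.toLinearMap.flip v)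
  let C : WithConv (H →ₗ[k] T) := toConv (LinearMap.toSpanSingleton k T (ιV M v) ∘ₗ counit)
  have hPI : P * I = 1 := by
    apply WithConv.ext
    ext x
    have := congrArg (ιH M) (HopfAlgebra.sum_antipode_mul_eq_algebraMap_counit (ℛ k x))
    have e := (ℛ k x).convMul_apply P I
    refine e.trans ?_
    simpa [P, I] using this
  have hIP : I * P = 1 := by
    apply WithConv.ext
    ext x
    have := congrArg (ιH M) (HopfAlgebra.sum_mul_antipode_eq_algebraMap_counit (ℛ k x))
    have e := (ℛ k x).convMul_apply I P
    refine e.trans ?_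
    simpa [P, I] using this
  have hQI : Q * I = I * C := by
    apply WithConv.ext
    ext x
    refine ((ℛ k x).convMul_apply Q I).trans (Eq.trans ?_ ((ℛ k x).convMul_apply I C).symm)
    have e := congrArg (fun y => ιH M y * ιV M v) (sum_counit_smul_right (k := k) x)
    simp only [map_sum, map_smul, Finset.sum_mul, smul_mul_assoc] at e
    simp [Q, I, C]
    rw [← cross', e]
  have key : P * Q = C * P := by
    calc P * Q = P * (Q * I) * P := by rw [mul_assoc, mul_assoc, hIP, mul_one]
      _ = C * P := by rw [hQI, ← mul_assoc, hPI, one_mul]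
  have := congrArg (fun F : WithConv (H →ₗ[k] T) => F.ofConv h) key
  have e1 := (ℛ k h).convMul_apply P Q
  have e2 := (ℛ k h).convMul_apply C P
  have e3 := e1.symm.trans (this.trans e2)
  have e := congrArg (fun y => ιV M v * ιH M (HopfAlgebra.antipode k y)) (sum_counit_smul (ℛ k h))
  simp only [map_sum, map_smul, Finset.mul_sum, mul_smul_comm] at e
  simp [P, Q, C] at e3
  rw [e3, e]


open Coalgebra in
/-- The antipode of `T(V) # H`, as an algebra map to the opposite algebra: that of `H`, and
`S(v) = - S(v₍₋₁₎) v₍₀₎`. -/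
def antipodeHom : M.TensorBosonization →ₐ[k] (M.TensorBosonization)ᵐᵒᵖ :=
  lift M ((AlgHom.op (ιH M)).comp (HopfAlgebra.antipodeAlgHomOp k H))
    (-((MulOpposite.opLinearEquiv k).toLinearMap ∘ₗ LinearMap.mul' k M.TensorBosonization ∘ₗ
      TensorProduct.map ((ιH M).toLinearMap ∘ₗ HopfAlgebra.antipode k) (ιV M) ∘ₗ M.coact)) (by
    intro h v
    obtain ⟨S, hS⟩ := TensorProduct.exists_finset (M.coact v)
    have L : ∀ (x : H ⊗[k] V) (b : H), LinearMap.mul' k M.TensorBosonization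
        (TensorProduct.map ((ιH M).toLinearMap ∘ₗ HopfAlgebra.antipode k) (ιV M)
          ((LinearMap.mul' k H).rTensor V (TensorProduct.rightComm k H V H (x ⊗ₜ[k] b)))) =
        ιH M (HopfAlgebra.antipode k b) * LinearMap.mul' k M.TensorBosonization
          (TensorProduct.map ((ιH M).toLinearMap ∘ₗ HopfAlgebra.antipode k) (ιV M) x) := by
      intro x b
      induction x using TensorProduct.induction_on with
      | zero => simp
      | tmul x y => simp [HopfAlgebra.antipode_mul_antidistrib, mul_assoc]
      | add x y hx hy => simp only [TensorProduct.add_tmul, map_add, hx, hy, mul_add]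
    have Y := congrArg (fun t => LinearMap.mul' k M.TensorBosonization
      (TensorProduct.map ((ιH M).toLinearMap ∘ₗ HopfAlgebra.antipode k) (ιV M) t)) (M.compat h v)
    have R : Coalgebra.comul (R := k) h =
      ∑ i ∈ (ℛ k h).index, (ℛ k h).left i ⊗ₜ[k] (ℛ k h).right i := (ℛ k h).eq.symm
    rw [R] at Y
    simp only [hS, map_sum, TensorProduct.map_tmul, L, LinearMap.id_coe, id_eq,
      LinearMap.comp_apply,
      LinearMap.flip_apply, TensorProduct.sum_tmul, TensorProduct.tmul_sum,
      TensorProduct.tensorTensorTensorComm_tmul, LinearMap.mul'_apply, TensorProduct.lift.tmul,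
      AlgHom.toLinearMap_apply, HopfAlgebra.antipode_mul_antidistrib, map_mul, mul_assoc] at Y
    simp only [← Finset.mul_sum, antipode_cross] at Y
    rw [R]
    apply MulOpposite.unop_injective
    simpa [hS, Finset.sum_mul, mul_assoc] using Y)

theorem antipodeHom_ιH (h : H) :
    (antipodeHom M (ιH M h)).unop = ιH M (HopfAlgebra.antipode k h) := by
  simp [antipodeHom]

theorem antipodeHom_ιV (v : V) :
    (antipodeHom M (ιV M v)).unop = -LinearMap.mul' k M.TensorBosonization
      (TensorProduct.map ((ιH M).toLinearMap ∘ₗ HopfAlgebra.antipode k) (ιV M) (M.coact v)) := by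
  simp [antipodeHom]

instance : HopfAlgebraStruct k M.TensorBosonization where
  antipode := (MulOpposite.opLinearEquiv k).symm.toLinearMap ∘ₗ (antipodeHom M).toLinearMap

@[simp] theorem antipode_ιH (h : H) : HopfAlgebra.antipode k (ιH M h) =
    ιH M (HopfAlgebra.antipode k h) := antipodeHom_ιH M h

@[simp] theorem antipode_ιV (v : V) : HopfAlgebra.antipode k (ιV M v) =
    -LinearMap.mul' k M.TensorBosonization (TensorProduct.map
      ((ιH M).toLinearMap ∘ₗ HopfAlgebra.antipode k) (ιV M) (M.coact v)) := antipodeHom_ιV M v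

theorem antipode_mul (a b : M.TensorBosonization) : HopfAlgebra.antipode k (a * b) =
    HopfAlgebra.antipode k b * HopfAlgebra.antipode k a :=
  congrArg MulOpposite.unop (map_mul (antipodeHom M) a b)

theorem antipode_one' : HopfAlgebra.antipode k (1 : M.TensorBosonization) = 1 :=
  congrArg MulOpposite.unop (map_one (antipodeHom M))

open Coalgebra in
instance : HopfAlgebra k M.TensorBosonization where
  mul_antipode_rTensor_comul := by
    ext a
    simp only [LinearMap.comp_apply, Algebra.linearMap_apply]
    induction a using induction with
    | hH h =>
      have := congrArg (ιH M) (HopfAlgebra.sum_antipode_mul_eq_algebraMap_counit (ℛ k h))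
      simp only [comul_ιH, counit_ιH]
      conv_lhs => rw [← (ℛ k h).eq]
      simpa using this
    | hV v => 
      obtain ⟨S, hS⟩ := TensorProduct.exists_finset (M.coact v)
      simp [hS]
    | hmul a b ha hb =>
      rw [Bialgebra.comul_mul, Bialgebra.counit_mul]
      rw [← (ℛ k a).eq] at ha ⊢
      rw [← (ℛ k b).eq] at hb ⊢
      simp only [map_sum, LinearMap.rTensor_tmul, LinearMap.mul'_apply, Finset.sum_mul,
        Finset.mul_sum, Algebra.TensorProduct.tmul_mul_tmul, antipode_mul, map_mul] at ha hb ⊢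
      rw [← hb, Finset.mul_sum]
      refine Finset.sum_congr rfl fun j _ => ?_
      rw [← mul_assoc, Algebra.commutes, mul_assoc, ← ha, Finset.sum_mul, Finset.mul_sum]
      exact Finset.sum_congr rfl fun i _ => by simp only [mul_assoc]
    | hadd a b ha hb => simp only [map_add, ha, hb]
  mul_antipode_lTensor_comul := by
    ext a
    simp only [LinearMap.comp_apply, Algebra.linearMap_apply]
    induction a using induction with
    | hH h =>
      have := congrArg (ιH M) (HopfAlgebra.sum_mul_antipode_eq_algebraMap_counit (ℛ k h))
      simp only [comul_ιH, counit_ιH]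
      conv_lhs => rw [← (ℛ k h).eq]
      simpa using this
    | hV v => 
      obtain ⟨S, hS⟩ := TensorProduct.exists_finset (M.coact v)
      have L : ∀ (x : H ⊗[k] H) (w : V), LinearMap.mul' k M.TensorBosonization
            ((LinearMap.mul' k M.TensorBosonization).lTensor M.TensorBosonization
            (TensorProduct.map (ιH M).toLinearMap
              (TensorProduct.map ((ιH M).toLinearMap ∘ₗ HopfAlgebra.antipode k) (ιV M))
              (TensorProduct.assoc k H H V (x ⊗ₜ[k] w)))) =
          ιH M (LinearMap.mul' k H ((HopfAlgebra.antipode k).lTensor H x)) * ιV M w := by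
        intro x w
        induction x using TensorProduct.induction_on with
        | zero => simp
        | tmul x y => simp [mul_assoc]
        | add x y hx hy => simp only [TensorProduct.add_tmul, map_add, hx, hy, add_mul]
      have A := congrArg (fun t => LinearMap.mul' k M.TensorBosonization
        ((LinearMap.mul' k M.TensorBosonization).lTensor M.TensorBosonization
          (TensorProduct.map (ιH M).toLinearMap
            (TensorProduct.map ((ιH M).toLinearMap ∘ₗ HopfAlgebra.antipode k) (ιV M)) t)))
        (M.coassoc v)
      have C := congrArg (ιV M) (M.counit_coact v)
      simp only [hS, map_sum, LinearMap.rTensor_tmul, L, LinearMap.lTensor_tmul,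
        TensorProduct.map_tmul, AlgHom.toLinearMap_apply, LinearMap.mul'_apply,
        HopfAlgebra.mul_antipode_lTensor_comul_apply, AlgHom.commutes, TensorProduct.lid_tmul,
        map_smul, ← Algebra.smul_def] at A C
      simp [hS, antipode_one', ← A, C]
    | hmul a b ha hb =>
      rw [Bialgebra.comul_mul, Bialgebra.counit_mul]
      rw [← (ℛ k a).eq] at ha ⊢
      rw [← (ℛ k b).eq] at hb ⊢
      simp only [map_sum, LinearMap.lTensor_tmul, LinearMap.mul'_apply, Finset.sum_mul,
        Finset.mul_sum, Algebra.TensorProduct.tmul_mul_tmul, antipode_mul, map_mul] at ha hb ⊢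
      rw [← ha, Finset.sum_mul, Finset.sum_comm]
      refine Finset.sum_congr rfl fun i _ => ?_
      rw [mul_assoc, ← Algebra.commutes, ← mul_assoc, ← hb, Finset.mul_sum, Finset.sum_mul]
      exact Finset.sum_congr rfl fun j _ => by simp only [mul_assoc]
    | hadd a b ha hb => simp only [map_add, ha, hb]

end TensorBosonization

end YDModule

/-- The algebra `k^G` of functions on the finite group `G`, with pointwise operations. -/
def FunctionAlgebra (k : Type u) (G : Type v) : Type (max u v) := G → k

namespace FunctionAlgebra

variable (k : Type u) {G : Type v} [Field k] [Group G] [Fintype G] [DecidableEq G]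

instance : CommRing (FunctionAlgebra k G) := inferInstanceAs (CommRing (G → k))
instance : Algebra k (FunctionAlgebra k G) := inferInstanceAs (Algebra k (G → k))

/-- The function `δ_g`, the indicator of `{g}`. -/
def δ (g : G) : FunctionAlgebra k G := Pi.single (M := fun _ : G => k) g 1

variable {k}

/-- The value of a function at `g`. -/
def eval (g : G) : FunctionAlgebra k G →ₐ[k] k := Pi.evalAlgHom k (fun _ : G => k) g

theorem ext {f f' : FunctionAlgebra k G} (h : ∀ g, eval g f = eval g f') : f = f' := funext h

@[simp] theorem eval_δ (g h : G) : eval g (δ k h) = if g = h then 1 else 0 :=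
  Pi.single_apply h (1 : k) g

theorem sum_eval (f : FunctionAlgebra k G) : ∑ g, eval g f • δ k g = f :=
  ext fun h => by simp [map_sum]

theorem δ_mul_δ (g h : G) : δ k g * δ k h = if g = h then δ k g else 0 :=
  ext fun x => by
    by_cases e : g = h
    · subst e; simp
    · simp only [map_mul, eval_δ, if_neg e, map_zero]
      by_cases e' : x = g
      · subst e'; simp [e]
      · simp [e']

variable (k) in
theorem sum_δ : ∑ g : G, δ k g = 1 := ext fun h => by simp [map_sum]

theorem hom_ext {N : Type*} [AddCommMonoid N] [Module k N] {φ ψ : FunctionAlgebra k G →ₗ[k] N}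
    (h : ∀ g, φ (δ k g) = ψ (δ k g)) : φ = ψ := by
  ext f
  rw [← sum_eval f]
  simp [map_sum, h]

/-- `Δ(f) = ∑ f(gh) δ_g ⊗ δ_h` and `ε(f) = f(1)`. -/
instance : CoalgebraStruct k (FunctionAlgebra k G) where
  comul := ∑ g : G, ∑ h : G,
    (LinearMap.toSpanSingleton k _ (δ k g ⊗ₜ[k] δ k h)) ∘ₗ (eval (g * h)).toLinearMap
  counit := (eval 1).toLinearMap

@[simp] theorem counit_apply (f : FunctionAlgebra k G) : Coalgebra.counit (R := k) f = eval 1 f := rfl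

theorem comul_apply (f : FunctionAlgebra k G) :
    Coalgebra.comul (R := k) f = ∑ g : G, ∑ h : G, eval (g * h) f • (δ k g ⊗ₜ[k] δ k h) := by
  change (∑ g : G, ∑ h : G, (LinearMap.toSpanSingleton k _ (δ k g ⊗ₜ[k] δ k h)) ∘ₗ
    (eval (g * h)).toLinearMap : FunctionAlgebra k G →ₗ[k] _) f = _
  simp [LinearMap.sum_apply]

theorem comul_δ (x : G) :
    Coalgebra.comul (R := k) (δ k x) = ∑ g : G, δ k g ⊗ₜ[k] δ k (g⁻¹ * x) := by
  rw [comul_apply]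
  refine Finset.sum_congr rfl fun g _ => ?_
  rw [Finset.sum_eq_single (g⁻¹ * x)]
  · simp
  · intro b _ hb
    have : ¬ g * b = x := fun e => hb (by rw [← e]; group)
    simp [this]
  · simp

instance : Coalgebra k (FunctionAlgebra k G) where
  coassoc := hom_ext fun x => by
    simp only [LinearMap.comp_apply, comul_δ, map_sum, LinearMap.rTensor_tmul,
      LinearMap.lTensor_tmul, TensorProduct.sum_tmul, TensorProduct.tmul_sum, LinearEquiv.coe_coe,
      TensorProduct.assoc_tmul]
    rw [Finset.sum_comm]
    refine Finset.sum_congr rfl fun g _ => ?_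
    refine Fintype.sum_equiv (Equiv.mulLeft g⁻¹) _ _ fun h => ?_
    simp [mul_assoc]
  rTensor_counit_comp_comul := hom_ext fun x => by
    simp only [LinearMap.comp_apply, comul_δ, map_sum, LinearMap.rTensor_tmul, counit_apply, eval_δ]
    rw [Finset.sum_eq_single 1]
    · simp
    · intro b _ hb; simp [hb.symm]
    · simp
  lTensor_counit_comp_comul := hom_ext fun x => by
    simp only [LinearMap.comp_apply, comul_δ, map_sum, LinearMap.lTensor_tmul, counit_apply, eval_δ]
    rw [Finset.sum_eq_single x]
    · simp
    · intro b _ hb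
      have : ¬ 1 = b⁻¹ * x := fun e => hb (by rw [← mul_one b, e]; group)
      simp [this]
    · simp

instance : Bialgebra k (FunctionAlgebra k G) :=
  Bialgebra.mk' k _ (by simp) (by intros; simp)
    (by
      rw [comul_apply]
      simp only [map_one, one_smul, ← TensorProduct.tmul_sum, ← TensorProduct.sum_tmul, sum_δ]
      rfl)
    (by
      intro a b
      simp only [comul_apply, Finset.sum_mul_sum, smul_mul_smul_comm,
        Algebra.TensorProduct.tmul_mul_tmul, δ_mul_δ, TensorProduct.ite_tmul, TensorProduct.tmul_ite,
        TensorProduct.zero_tmul, TensorProduct.tmul_zero, smul_ite, smul_zero, Finset.sum_ite_eq,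
        Finset.sum_ite_irrel, Finset.sum_const_zero, Finset.mem_univ, if_true, map_mul])

/-- `S(f)(g) = f(g⁻¹)`. -/
instance : HopfAlgebraStruct k (FunctionAlgebra k G) where
  antipode := ∑ g : G, (LinearMap.toSpanSingleton k _ (δ k g)) ∘ₗ (eval g⁻¹).toLinearMap

theorem antipode_δ (x : G) : HopfAlgebra.antipode k (δ k x) = δ k x⁻¹ := by
  change (∑ g : G, (LinearMap.toSpanSingleton k _ (δ k g)) ∘ₗ
    (eval g⁻¹).toLinearMap : FunctionAlgebra k G →ₗ[k] _) (δ k x) = _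
  simp [LinearMap.sum_apply, inv_eq_iff_eq_inv]

instance : HopfAlgebra k (FunctionAlgebra k G) where
  mul_antipode_rTensor_comul := hom_ext fun x => by
    simp only [LinearMap.comp_apply, comul_δ, map_sum, LinearMap.rTensor_tmul, antipode_δ,
      LinearMap.mul'_apply, δ_mul_δ, counit_apply, eval_δ, left_eq_mul, Algebra.linearMap_apply]
    by_cases e : x = 1
    · subst e
      simp only [if_true, map_one]
      rw [← sum_δ k]
      exact Fintype.sum_equiv (Equiv.inv G) _ _ fun _ => rfl
    · simp [e, Ne.symm e]
  mul_antipode_lTensor_comul := hom_ext fun x => by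
    simp only [LinearMap.comp_apply, comul_δ, map_sum, LinearMap.lTensor_tmul, antipode_δ,
      LinearMap.mul'_apply, δ_mul_δ, counit_apply, eval_δ, Algebra.linearMap_apply, mul_inv_rev,
      inv_inv, right_eq_mul, inv_eq_one]
    by_cases e : x = 1
    · subst e
      simp only [if_true, map_one]
      exact sum_δ k
    · simp [e, Ne.symm e]

end FunctionAlgebra

namespace YDModule

section Nichols

variable {k : Type u} {H : Type v} {V : Type w} [Field k] [Ring H] [HopfAlgebra k H]
    [AddCommGroup V] [Module k V] (M : YDModule k H V)

open TensorBosonization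

/-- The homogeneous component `T^m(V) # H` of `T(V) # H`. -/
def tensorComponent (m : ℕ) : Submodule k M.TensorBosonization :=
  LinearMap.range (ιV M) ^ m * LinearMap.range (ιH M).toLinearMap

/-- The largest Hopf ideal of `T(V) # H` contained in `⨁_{m ≥ 2} T^m(V) # H`. It is `I(V) # H`,
where `I(V)`, the largest ideal and coideal of the braided Hopf algebra `T(V)` contained in
`⨁_{m ≥ 2} T^m(V)`, is the ideal that defines the Nichols algebra `B(V) = T(V) / I(V)`. -/
def nicholsIdeal : Ideal M.TensorBosonization :=
  sSup {I | I.IsTwoSided ∧ I.IsHopfIdeal k ∧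
    I.restrictScalars k ≤ ⨆ m : ℕ, ⨆ _ : 2 ≤ m, M.tensorComponent m}

variable {M} in
theorem nicholsIdeal_induction {C : M.TensorBosonization → Prop} {x : M.TensorBosonization}
    (hx : x ∈ M.nicholsIdeal)
    (mem : ∀ I : Ideal M.TensorBosonization, I.IsTwoSided → I.IsHopfIdeal k → I ≤ M.nicholsIdeal →
      ∀ y ∈ I, C y)
    (zero : C 0) (add : ∀ y z, C y → C z → C (y + z)) : C x := by
  rw [nicholsIdeal, sSup_eq_iSup'] at hx
  exact Submodule.iSup_induction _ (motive := C) hx (fun I y hy => mem I I.2.1 I.2.2.1 (le_sSup I.2) y hy) zero add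

instance : M.nicholsIdeal.IsTwoSided where
  mul_mem_of_left b ha := nicholsIdeal_induction (C := fun a => a * b ∈ M.nicholsIdeal) ha
    (fun _ _ _ hI _ hy => hI (Ideal.mul_mem_right b _ hy)) (by simp)
    (fun y z hy hz => by rw [add_mul]; exact M.nicholsIdeal.add_mem hy hz)

instance : M.nicholsIdeal.IsHopfIdeal k where
  counit_eq_zero _ hx := nicholsIdeal_induction
    (C := fun y => Coalgebra.counit (R := k) y = 0) hx
    (fun _ _ h _ _ hy => h.counit_eq_zero hy) (by simp)
    (fun y z hy hz => by rw [map_add, hy, hz, add_zero])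
  map_mkQ_comul_eq_zero x hx := nicholsIdeal_induction
    (C := fun y => TensorProduct.map (M.nicholsIdeal.restrictScalars k).mkQ
      (M.nicholsIdeal.restrictScalars k).mkQ (Coalgebra.comul (R := k) y) = 0) hx
    (fun I _ h hI y hy => by
      have hI' : I.restrictScalars k ≤ M.nicholsIdeal.restrictScalars k := fun z hz => hI hz
      have e : (M.nicholsIdeal.restrictScalars k).mkQ =
          Submodule.factor hI' ∘ₗ (I.restrictScalars k).mkQ := by ext; simp
      rw [e, TensorProduct.map_comp, LinearMap.comp_apply, h.map_mkQ_comul_eq_zero hy, map_zero])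
    (by simp) (fun y z hy hz => by rw [map_add, map_add, hy, hz, add_zero])
  antipode_mem _ hx := nicholsIdeal_induction
    (C := fun y => HopfAlgebra.antipode k y ∈ M.nicholsIdeal) hx
    (fun _ _ h hI _ hy => hI (h.antipode_mem hy)) (by simp)
    (fun y z hy hz => by rw [map_add]; exact M.nicholsIdeal.add_mem hy hz)

/-- The bosonization `B(V) # H` of the Nichols algebra `B(V)`. -/
abbrev NicholsBosonization : Type (max u v w) := M.TensorBosonization ⧸ M.nicholsIdeal

namespace NicholsBosonization

/-- The inclusion of `H` in `B(V) # H`. -/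
def ιH : H →ₐ[k] M.NicholsBosonization :=
  (Ideal.Quotient.mkₐ k M.nicholsIdeal).comp (TensorBosonization.ιH M)

/-- The inclusion of `V` in `B(V) # H`. -/
def ιV : V →ₗ[k] M.NicholsBosonization :=
  (Ideal.Quotient.mkₐ k M.nicholsIdeal).toLinearMap ∘ₗ TensorBosonization.ιV M

/-- The homogeneous component `B^m(V) # H` of `B(V) # H`. -/
def component (m : ℕ) : Submodule k M.NicholsBosonization :=
  LinearMap.range (ιV M) ^ m * LinearMap.range (ιH M).toLinearMap

end NicholsBosonization

end Nichols

section Compat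

variable {k : Type u} {H : Type v} {V : Type w} [Field k] [Ring H] [HopfAlgebra k H]
    [AddCommGroup V] [Module k V]

/-- The compatibility of a Yetter-Drinfeld module may be checked on spanning sets. -/
theorem compat_of_span (act : H →ₐ[k] Module.End k V) (coact : V →ₗ[k] H ⊗[k] V)
    {A : Set H} {B : Set V} (hA : Submodule.span k A = ⊤) (hB : Submodule.span k B = ⊤)
    (hAB : ∀ h ∈ A, ∀ v ∈ B,
      TensorProduct.map (LinearMap.mul' k H) (TensorProduct.lift act.toLinearMap)
        (TensorProduct.tensorTensorTensorComm k H H H V (Coalgebra.comul (R := k) h ⊗ₜ[k] coact v)) =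
      (LinearMap.mul' k H).rTensor V (TensorProduct.rightComm k H V H
        (TensorProduct.map (coact ∘ₗ act.toLinearMap.flip v) LinearMap.id
          (Coalgebra.comul (R := k) h)))) (h : H) (v : V) :
      TensorProduct.map (LinearMap.mul' k H) (TensorProduct.lift act.toLinearMap)
        (TensorProduct.tensorTensorTensorComm k H H H V (Coalgebra.comul (R := k) h ⊗ₜ[k] coact v)) =
      (LinearMap.mul' k H).rTensor V (TensorProduct.rightComm k H V H
        (TensorProduct.map (coact ∘ₗ act.toLinearMap.flip v) LinearMap.id
          (Coalgebra.comul (R := k) h))) := by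
  have hh : h ∈ Submodule.span k A := hA ▸ Submodule.mem_top
  have hv : v ∈ Submodule.span k B := hB ▸ Submodule.mem_top
  induction hh using Submodule.span_induction with
  | mem h hh =>
    induction hv using Submodule.span_induction with
    | mem v hv => exact hAB h hh v hv
    | zero => simp
    | add v w _ _ iv iw =>
      simp only [map_add, TensorProduct.tmul_add, iv, iw, LinearMap.comp_add,
        TensorProduct.map_add_left, LinearMap.add_apply]
    | smul c v _ iv =>
      simp only [map_smul, TensorProduct.tmul_smul, iv, LinearMap.comp_smul,
        TensorProduct.map_smul_left, LinearMap.smul_apply]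
  | zero => simp
  | add h h' _ _ i i' => simp only [map_add, TensorProduct.add_tmul, i, i']
  | smul c h _ i => rw [map_smul, ← TensorProduct.smul_tmul', map_smul, map_smul, i, map_smul, map_smul, map_smul]

end Compat

end YDModule

/-- The transpositions of the symmetric group on `n` letters. -/
abbrev Transposition (n : ℕ) : Type := {η : Equiv.Perm (Fin n) // η.IsSwap}

instance (n : ℕ) : Fintype (Transposition n) := Fintype.ofFinite _

namespace Transposition

/-- The conjugate `ω η ω⁻¹`. -/
def conj {n : ℕ} (ω : Equiv.Perm (Fin n)) (η : Transposition n) : Transposition n :=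
  ⟨ω * η.1 * ω⁻¹, by
    obtain ⟨x, y, hxy, h⟩ := η.2
    exact ⟨ω x, ω y, ω.injective.ne hxy, by rw [h, Equiv.mul_swap_eq_swap_mul]; simp⟩⟩

theorem conj_one {n : ℕ} (η : Transposition n) : conj 1 η = η := Subtype.ext (by simp [conj])

theorem conj_conj {n : ℕ} (ω ω' : Equiv.Perm (Fin n)) (η : Transposition n) :
    conj ω (conj ω' η) = conj (ω * ω') η := Subtype.ext (by simp [conj, mul_assoc])

end Transposition

/-- The sign of `ω`, as a scalar. -/
def sgn (k : Type u) [Field k] {n : ℕ} (ω : Equiv.Perm (Fin n)) : k :=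
  ((Equiv.Perm.sign ω : ℤ) : k)

theorem sgn_mul (k : Type u) [Field k] {n : ℕ} (ω ω' : Equiv.Perm (Fin n)) :
    sgn k (ω * ω') = sgn k ω * sgn k ω' := by simp [sgn]

theorem sgn_one (k : Type u) [Field k] {n : ℕ} : sgn k (1 : Equiv.Perm (Fin n)) = 1 := by simp [sgn]

section Concrete

variable (k : Type u) [Field k] (n : ℕ)

open Transposition FunctionAlgebra

theorem span_single {ι : Type*} :
    Submodule.span k (Set.range fun i : ι => Finsupp.single i (1 : k)) = ⊤ := by
  rw [eq_top_iff]
  rintro v -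
  induction v using Finsupp.induction_linear with
  | zero => exact Submodule.zero_mem _
  | add v w hv hw => exact Submodule.add_mem _ hv hw
  | single i c =>
    have := Submodule.smul_mem _ c (Submodule.subset_span (R := k)
      (Set.mem_range_self (f := fun i : ι => Finsupp.single i (1 : k)) i))
    simpa using this

theorem span_δ {G : Type*} [Group G] [Fintype G] [DecidableEq G] :
    Submodule.span k (Set.range (δ k (G := G))) = ⊤ := by
  rw [eq_top_iff]
  rintro f -
  rw [← sum_eval f]
  exact Submodule.sum_mem _ fun g _ =>
    Submodule.smul_mem _ _ (Submodule.subset_span (Set.mem_range_self g))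

theorem span_of {G : Type*} [Group G] :
    Submodule.span k (Set.range (MonoidAlgebra.of k G)) = ⊤ := by
  rw [eq_top_iff]
  rintro f -
  induction f using MonoidAlgebra.induction_linear with
  | zero => exact Submodule.zero_mem _
  | add v w hv hw => exact Submodule.add_mem _ hv hw
  | single i c =>
    have := Submodule.smul_mem _ c (Submodule.subset_span (R := k)
      (Set.mem_range_self (f := MonoidAlgebra.of k G) i))
    simpa using this

/-- The Yetter-Drinfeld module `V` over `k^{S_n}` with basis `y_η`, `η` a transposition, action
`δ_τ · y_η = δ_{τ,η} y_η` and coaction `y_η ↦ ∑_ω sgn(ω) δ_ω ⊗ y_{ω⁻¹ηω}`. -/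
def ydFun : YDModule k (FunctionAlgebra k (Equiv.Perm (Fin n))) (Transposition n →₀ k) where
  act := AlgHom.ofLinearMap
    { toFun := fun f => Finsupp.linearCombination k fun η : Transposition n =>
        eval η.1 f • Finsupp.single η (1 : k)
      map_add' := fun f f' => by ext; simp [add_smul]
      map_smul' := fun c f => by ext; simp [mul_smul] }
    (by ext; simp) (fun f f' => by ext; simp [mul_comm])
  coact := Finsupp.linearCombination k fun η : Transposition n => ∑ ω : Equiv.Perm (Fin n),
    sgn k ω • (δ k ω ⊗ₜ[k] Finsupp.single (conj ω⁻¹ η) (1 : k))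
  counit_coact v := by
    induction v using Finsupp.induction_linear with
    | zero => simp
    | add v w hv hw => simp only [map_add, hv, hw]
    | single η c =>
      simp [conj_one, sgn_one]
  coassoc v := by
    induction v using Finsupp.induction_linear with
    | zero => simp
    | add v w hv hw => simp only [map_add, hv, hw]
    | single η c =>
      simp only [Finsupp.linearCombination_single, map_smul, map_sum, LinearMap.rTensor_tmul,
        comul_δ, TensorProduct.sum_tmul, TensorProduct.assoc_tmul, LinearMap.lTensor_tmul,
        TensorProduct.tmul_sum, TensorProduct.tmul_smul, conj_conj, one_smul, Finset.smul_sum]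
      rw [Finset.sum_comm]
      refine Finset.sum_congr rfl fun g _ => ?_
      refine Fintype.sum_equiv (Equiv.mulLeft g⁻¹) _ _ fun h => ?_
      simp [smul_smul, ← mul_assoc, ← sgn_mul]
  compat := YDModule.compat_of_span _ _ (A := Set.range (δ k))
    (B := Set.range fun η => Finsupp.single η (1 : k)) (span_δ k) (span_single k) (by
    rintro _ ⟨τ, rfl⟩ _ ⟨η, rfl⟩
    simp only [comul_δ, TensorProduct.sum_tmul, TensorProduct.tmul_sum, map_sum,
      Finsupp.linearCombination_single, one_smul, TensorProduct.tmul_smul, map_smul,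
      TensorProduct.tensorTensorTensorComm_tmul, TensorProduct.map_tmul, LinearMap.mul'_apply,
      δ_mul_δ, TensorProduct.lift.tmul, AlgHom.toLinearMap_apply, AlgHom.ofLinearMap_apply,
      LinearMap.coe_mk, AddHom.coe_mk, eval_δ, LinearMap.comp_apply, LinearMap.flip_apply,
      LinearMap.id_apply]
    rw [Finset.sum_eq_single (f := fun x => LinearMap.rTensor (Transposition n →₀ k) _ _) η.1 (fun b _ hb => by simp [Ne.symm hb]) (by simp)]
    simp only [if_true, one_smul, map_sum, map_smul,
      TensorProduct.sum_tmul, ← TensorProduct.smul_tmul', TensorProduct.rightComm_tmul,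
      LinearMap.rTensor_tmul, LinearMap.mul'_apply, δ_mul_δ]
    refine Finset.sum_congr rfl fun g _ => ?_
    rw [Finset.sum_eq_single g (fun b _ hb => by simp [hb]) (by simp)]
    have e : ((conj g⁻¹ η).1 = g⁻¹ * τ) ↔ g = η.1⁻¹ * τ := by
      simp only [conj, inv_inv, mul_assoc, mul_right_inj]
      rw [eq_inv_mul_iff_mul_eq]
    by_cases h : g = η.1⁻¹ * τ
    · rw [if_pos rfl, if_pos (e.2 h), if_pos h, one_smul]
    · rw [if_neg (mt e.1 h), if_neg h]; simp)

/-- The Yetter-Drinfeld module `V^*` over `k S_n` with basis `x_η`, `η` a transposition, action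
`ω · x_η = sgn(ω) x_{ωηω⁻¹}` and coaction `x_η ↦ η ⊗ x_η`. -/
def ydGroup : YDModule k (MonoidAlgebra k (Equiv.Perm (Fin n))) (Transposition n →₀ k) where
  act := MonoidAlgebra.lift k (Module.End k (Transposition n →₀ k)) (Equiv.Perm (Fin n))
    { toFun := fun ω => sgn k ω • Finsupp.lmapDomain k k (conj ω)
      map_one' := by ext; simp [sgn_one, conj_one]
      map_mul' := fun ω ω' => by ext; simp [sgn_mul, mul_comm, conj_conj] }
  coact := Finsupp.linearCombination k fun η : Transposition n =>
    MonoidAlgebra.of k _ η.1 ⊗ₜ[k] Finsupp.single η (1 : k)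
  counit_coact v := by
    induction v using Finsupp.induction_linear with
    | zero => simp
    | add v w hv hw => simp only [map_add, hv, hw]
    | single η c =>
      simp
  coassoc v := by
    induction v using Finsupp.induction_linear with
    | zero => simp
    | add v w hv hw => simp only [map_add, hv, hw]
    | single η c =>
      simp
  compat := YDModule.compat_of_span _ _ (A := Set.range (MonoidAlgebra.of k _))
    (B := Set.range fun η => Finsupp.single η (1 : k)) (span_of k) (span_single k) (by
    rintro _ ⟨τ, rfl⟩ _ ⟨η, rfl⟩
    simp only [MonoidAlgebra.of_apply, MonoidAlgebra.comul_single, CommSemiring.comul_apply,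
      TensorProduct.map_tmul, MonoidAlgebra.lsingle_apply, Finsupp.linearCombination_single, one_smul,
      TensorProduct.tensorTensorTensorComm_tmul, LinearMap.mul'_apply, TensorProduct.lift.tmul,
      AlgHom.toLinearMap_apply, MonoidAlgebra.lift_single, MonoidHom.coe_mk, OneHom.coe_mk,
      LinearMap.smul_apply, Finsupp.lmapDomain_apply, Finsupp.mapDomain_single,
      MonoidAlgebra.single_mul_single, mul_one, LinearMap.comp_apply, LinearMap.flip_apply,
      LinearMap.id_apply, map_smul, ← TensorProduct.smul_tmul', TensorProduct.tmul_smul,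
      TensorProduct.rightComm_tmul, LinearMap.rTensor_tmul]
    simp [conj])

end Concrete

section General

variable {k : Type u} [Field k]

/-- A twist for `A`: an invertible `J ∈ A ⊗ A` with
`(1 ⊗ J)(id ⊗ Δ)(J) = (J ⊗ 1)(Δ ⊗ id)(J)` and `(id ⊗ ε)(J) = (ε ⊗ id)(J) = 1`. -/
structure IsTwist {A : Type v} [Ring A] [HopfAlgebra k A] (J : A ⊗[k] A) : Prop where
  isUnit : IsUnit J
  twist : ((1 : A) ⊗ₜ[k] J) * (Coalgebra.comul (R := k)).lTensor A J =
    TensorProduct.assoc k A A A ((J ⊗ₜ[k] (1 : A)) * (Coalgebra.comul (R := k)).rTensor A J)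
  id_counit : TensorProduct.rid k A ((Coalgebra.counit (R := k)).lTensor A J) = 1
  counit_id : TensorProduct.lid k A ((Coalgebra.counit (R := k)).rTensor A J) = 1

/-- A normalized Hopf 2-cocycle on `A`: a convolution invertible linear map `σ : A ⊗ A → k` with
`σ(x₍₁₎, y₍₁₎) σ(x₍₂₎ y₍₂₎, z) = σ(y₍₁₎, z₍₁₎) σ(x, y₍₂₎ z₍₂₎)` and
`σ(x, 1) = σ(1, x) = ε(x)`. The two sides of the cocycle equation are the values at `x ⊗ y` and at
`y ⊗ z` of convolution products of linear forms on the coalgebra `A ⊗ A`. -/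
structure IsHopfTwoCocycle {A : Type v} [Ring A] [HopfAlgebra k A] (σ : A ⊗[k] A →ₗ[k] k) :
    Prop where
  isUnit : IsUnit (WithConv.toConv σ)
  cocycle : ∀ x y z : A,
    (WithConv.toConv σ * WithConv.toConv
      (σ ∘ₗ (TensorProduct.mk k A A).flip z ∘ₗ LinearMap.mul' k A)).ofConv (x ⊗ₜ[k] y) =
    (WithConv.toConv σ * WithConv.toConv
      (σ ∘ₗ TensorProduct.mk k A A x ∘ₗ LinearMap.mul' k A)).ofConv (y ⊗ₜ[k] z)
  right_one : ∀ x : A, σ (x ⊗ₜ[k] 1) = Coalgebra.counit (R := k) x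
  left_one : ∀ x : A, σ (1 ⊗ₜ[k] x) = Coalgebra.counit (R := k) x

/-- The extension `⟨a ⊗ b, x ⊗ y⟩ = ⟨a, x⟩ ⟨b, y⟩` of a bilinear pairing to the tensor squares. -/
def tensorPairing {A : Type v} {A' : Type w} [AddCommGroup A] [Module k A] [AddCommGroup A']
    [Module k A'] (B : A →ₗ[k] A' →ₗ[k] k) : A ⊗[k] A →ₗ[k] A' ⊗[k] A' →ₗ[k] k :=
  TensorProduct.dualDistrib k A' A' ∘ₗ TensorProduct.map B B

theorem tensorPairing_tmul {A : Type v} {A' : Type w} [AddCommGroup A] [Module k A]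
    [AddCommGroup A'] [Module k A'] (B : A →ₗ[k] A' →ₗ[k] k) (a b : A) (x y : A') :
    tensorPairing B (a ⊗ₜ[k] b) (x ⊗ₜ[k] y) = B a x * B b y := rfl

/-- A Hopf pairing between `A` and `A'`. -/
structure IsHopfPairing {A : Type v} {A' : Type w} [Ring A] [HopfAlgebra k A] [Ring A']
    [HopfAlgebra k A'] (B : A →ₗ[k] A' →ₗ[k] k) : Prop where
  one_left : ∀ x, B 1 x = Coalgebra.counit (R := k) x
  one_right : ∀ a, B a 1 = Coalgebra.counit (R := k) a
  mul_left : ∀ a b x, B (a * b) x = tensorPairing B (a ⊗ₜ[k] b) (Coalgebra.comul (R := k) x)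
  mul_right : ∀ a x y, B a (x * y) = tensorPairing B (Coalgebra.comul (R := k) a) (x ⊗ₜ[k] y)

end General

section FominKirillov

variable (k : Type u) [Field k] (n : ℕ)

open YDModule

/-- The bosonization `FK_n # k^{S_n}`, where `FK_n = B(V)`. -/
abbrev FKFun : Type u := (ydFun k n).NicholsBosonization

/-- The bosonization `B(V^*) # k S_n`. -/
abbrev FKGroup : Type u := (ydGroup k n).NicholsBosonization

variable {n}

/-- The generator `y_η` of `FK_n # k^{S_n}`. -/
def y (η : Transposition n) : FKFun k n := NicholsBosonization.ιV (ydFun k n) (Finsupp.single η 1)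

/-- The element `δ_ω` of `FK_n # k^{S_n}`. -/
def delta (ω : Equiv.Perm (Fin n)) : FKFun k n :=
  NicholsBosonization.ιH (ydFun k n) (FunctionAlgebra.δ k ω)

/-- The generator `x_η` of `B(V^*) # k S_n`. -/
def x (η : Transposition n) : FKGroup k n :=
  NicholsBosonization.ιV (ydGroup k n) (Finsupp.single η 1)

/-- The element `ω` of `B(V^*) # k S_n`. -/
def grp (ω : Equiv.Perm (Fin n)) : FKGroup k n :=
  NicholsBosonization.ιH (ydGroup k n) (MonoidAlgebra.of k _ ω)

variable (n)

/-- The element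
`J_n = 1 ⊗ 1 + ∑_ω sgn(ω) ∑_{η, τ} y_η δ_ω ⊗ y_{ω⁻¹ τ ω}` of the tensor square of
`FK_n # k^{S_n}`. -/
def J : FKFun k n ⊗[k] FKFun k n :=
  1 ⊗ₜ[k] 1 + ∑ ω : Equiv.Perm (Fin n), sgn k ω • ∑ η : Transposition n, ∑ τ : Transposition n,
    (y k η * delta k ω) ⊗ₜ[k] y k (Transposition.conj ω⁻¹ τ)

variable {n}

variable {k} in
/-- The values of the García-Mastnak cocycle on `B(V^*) # k S_n`:
`σ(x_τ ω, x_τ' ω') = sgn(ω)`, `σ(ω, ω') = 1`, and `σ` vanishes on all other pairs of homogeneous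
components. -/
structure IsGarciaMastnak (σ : FKGroup k n ⊗[k] FKGroup k n →ₗ[k] k) : Prop where
  one_one : ∀ (τ τ' : Transposition n) (ω ω' : Equiv.Perm (Fin n)),
    σ ((x k τ * grp k ω) ⊗ₜ[k] (x k τ' * grp k ω')) = sgn k ω
  zero_zero : ∀ ω ω' : Equiv.Perm (Fin n), σ (grp k ω ⊗ₜ[k] grp k ω') = 1
  elsewhere : ∀ i j : ℕ, (i, j) ≠ (0, 0) → (i, j) ≠ (1, 1) →
    ∀ a ∈ NicholsBosonization.component (ydGroup k n) i,
    ∀ b ∈ NicholsBosonization.component (ydGroup k n) j, σ (a ⊗ₜ[k] b) = 0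

variable {k} in
/-- The duality between `FK_n # k^{S_n}` and `B(V^*) # k S_n`: the Hopf pairing that extends the
evaluation pairing of `k^{S_n}` with `k S_n` and the pairing of `V` with `V^*` in which the `y_η` and
the `x_η` are dual bases. -/
structure IsDuality (B : FKFun k n →ₗ[k] FKGroup k n →ₗ[k] k) : Prop extends IsHopfPairing B where
  delta_grp : ∀ ω g : Equiv.Perm (Fin n), B (delta k ω) (grp k g) = if ω = g then 1 else 0
  y_x : ∀ η τ : Transposition n, B (y k η) (x k τ) = if η = τ then 1 else 0
  delta_x : ∀ (ω : Equiv.Perm (Fin n)) (τ : Transposition n), B (delta k ω) (x k τ) = 0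
  y_grp : ∀ (η : Transposition n) (g : Equiv.Perm (Fin n)), B (y k η) (grp k g) = 0

end FominKirillov

end

end FKTwist

/-! Put Y = ∑ y_η and let χ = ∑ sgn(ω) δ_ω be the sign, an element of k^{S_n}. Conjugation permutes
the transpositions, so for every ω the sum over τ in J_n is again Y, and J_n = 1 ⊗ 1 + Yχ ⊗ Y
(`J_eq`). The sign is grouplike with χ² = 1. The coaction sends ∑ y_η to χ ⊗ ∑ y_η, and χ acts on ∑
y_η by -1 because transpositions are odd. Hence Δ(Y) = Y ⊗ 1 + χ ⊗ Y and χY = -Yχ, so Y² is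
primitive. It pairs to zero with the generators of the dual side, and therefore Y² = 0 in the
Nichols algebra (`tensorY_mul_self_mem`). Thus Y and χ satisfy the relations of Sweedler's
four-dimensional Hopf algebra, and J_n is a twist already there: with P = Yχ all of P², Y², PY, YP
vanish, and the twist equation becomes a comparison of four terms (`isTwist_one_add_tmul`).

The duality is built on T(V) # k^{S_n} and T(V^*) # k S_n first. The elements of k^{S_n} and of V
give linear forms on T(V^*) # k S_n. These satisfy the cross relation in the convolution algebra
(`form_cross`), so they extend to an algebra map, which is multiplicativity in the first argument.
Multiplicativity in the second is `tensorDuality_mul_right`. The radicals of a Hopf pairing are Hopf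
ideals, and this pairing is nondegenerate in degrees zero and one. That forces each radical to be
the ideal of the Nichols algebra (`mem_nicholsIdeal_iff`): a Hopf ideal in degrees at least two
pairs to zero with the generators, hence with everything, and conversely the radical is a Hopf ideal
living in degrees at least two. The pairing therefore descends to a nondegenerate one of the two
bosonizations (`exists_quotient`).

The cocycle is taken to be the transpose of J_n, that is σ(x, x') = ε(x)ε(x') + ⟨Yχ, x⟩⟨Y, x'⟩. The
first summand lives in bidegree (0,0) and the second in (1,1), whence the García–Mastnak values
(`isGarciaMastnak_of_mk`). Transposition turns products into convolution products, so the cocycle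
identity follows from the same relations between P, Y and χ (`isHopfTwoCocycle`). Uniqueness of σ
holds because the homogeneous components span, and uniqueness of the pairing because the generators
generate. -/

namespace FKTwist

universe u v w

noncomputable section

/-! ### Hopf pairings, their radicals and quotients. -/

section Pairing

open WithConv Coalgebra

variable {k : Type u} [Field k] {A : Type v} {A' : Type w}

section Linear

variable [AddCommGroup A] [Module k A] [AddCommGroup A'] [Module k A']

theorem tensorPairing_flip (B : A →ₗ[k] A' →ₗ[k] k) (s : A ⊗[k] A) (t : A' ⊗[k] A') :
    tensorPairing B.flip t s = tensorPairing B s t := by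
  induction s using TensorProduct.induction_on with
  | zero => simp
  | add s s' hs hs' => simp only [map_add, LinearMap.add_apply, hs, hs']
  | tmul a b =>
    induction t using TensorProduct.induction_on with
    | zero => simp
    | add t t' ht ht' => simp only [map_add, LinearMap.add_apply, ht, ht']
    | tmul x y => simp [tensorPairing_tmul]

/-- A pairing with trivial left radical has trivial left radical on the tensor squares. -/
theorem eq_zero_of_tensorPairing (B : A →ₗ[k] A' →ₗ[k] k) (hB : ∀ a, (∀ x, B a x = 0) → a = 0)
    {t : A ⊗[k] A} (ht : ∀ x y, tensorPairing B t (x ⊗ₜ[k] y) = 0) : t = 0 := by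
  have h1 : ∀ y, TensorProduct.rid k A ((B.flip y).lTensor A t) = 0 := fun y => hB _ fun x => by
    rw [← ht x y]
    clear ht
    induction t using TensorProduct.induction_on with
    | zero => simp
    | add s s' hs hs' => simp only [map_add, LinearMap.add_apply, hs, hs']
    | tmul a b => simp [tensorPairing_tmul, mul_comm]
  -- Expanding t in a basis of the first factor leaves coefficients in the second. Vanishing of all
  -- contractions puts each coefficient in the left radical, which is zero.
  let e := Module.Basis.ofVectorSpace k A
  obtain ⟨c, rfl⟩ := TensorProduct.eq_repr_basis_left e t
  have h2 : ∀ y, (c.mapRange (fun b => B b y) (by simp)) = 0 := fun y => by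
    have := h1 y
    simp only [Finsupp.sum, map_sum, LinearMap.lTensor_tmul, TensorProduct.rid_tmul,
      LinearMap.flip_apply] at this
    refine (linearIndependent_iff.1 e.linearIndependent) _ ?_
    rw [Finsupp.linearCombination_apply, Finsupp.sum_mapRange_index (by simp)]
    exact this
  have h3 : c = 0 := by
    ext i
    exact hB _ fun y => by simpa using DFunLike.congr_fun (h2 y) i
  simp [h3]

theorem tensorPairing_map {C : Type*} {C' : Type*} [AddCommGroup C] [Module k C] [AddCommGroup C']
    [Module k C'] (B : A →ₗ[k] A' →ₗ[k] k) (D : C →ₗ[k] C' →ₗ[k] k) (p : A →ₗ[k] C)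
    (q : A' →ₗ[k] C') (h : ∀ a x, D (p a) (q x) = B a x) (s : A ⊗[k] A) (t : A' ⊗[k] A') :
    tensorPairing D (TensorProduct.map p p s) (TensorProduct.map q q t) = tensorPairing B s t := by
  induction s using TensorProduct.induction_on with
  | zero => simp
  | add s s' hs hs' => simp only [map_add, LinearMap.add_apply, hs, hs']
  | tmul a b =>
    induction t using TensorProduct.induction_on with
    | zero => simp
    | add t t' ht ht' => simp only [map_add, ht, ht']
    | tmul x y => simp [tensorPairing_tmul, h]

end Linear

variable [Ring A] [HopfAlgebra k A] [Ring A'] [HopfAlgebra k A'] {B : A →ₗ[k] A' →ₗ[k] k}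

/-- Multiplicativity in the first argument says that B carries products in A to convolution products
of forms on A'. Doing this in both factors gives the same on the coalgebra A' ⊗ A'. This is how
identities for a twist become identities for its transpose. -/
theorem tensorPairing_mul
    (hB : ∀ a b x, B (a * b) x = tensorPairing B (a ⊗ₜ[k] b) (comul (R := k) x))
    (s t : A ⊗[k] A) : toConv (tensorPairing B (s * t)) =
      toConv (tensorPairing B s) * toConv (tensorPairing B t) := by
  have hm : ∀ a b, toConv (B (a * b)) = toConv (B a) * toConv (B b) := fun a b => by
    ext x
    rw [LinearMap.convMul_apply]
    refine (hB a b x).trans ?_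
    rw [← (ℛ k x).eq]
    simp [tensorPairing_tmul]
  induction s using TensorProduct.induction_on with
  | zero => simp
  | add s s' hs hs' => simp only [add_mul, map_add, toConv_add, hs, hs']
  | tmul a b =>
    induction t using TensorProduct.induction_on with
    | zero => simp
    | add t t' ht ht' => simp only [mul_add, map_add, toConv_add, ht, ht']
    | tmul c d =>
      apply WithConv.ext
      ext x y
      have e1 := congrArg (fun f => f.ofConv x) (hm a c)
      have e2 := congrArg (fun f => f.ofConv y) (hm b d)
      simp only [LinearMap.convMul_def] at e1 e2
      simp only [LinearMap.convMul_def, Algebra.TensorProduct.tmul_mul_tmul,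
        TensorProduct.AlgebraTensorModule.curry_apply, LinearMap.restrictScalars_self,
        TensorProduct.curry_apply, tensorPairing_tmul, LinearMap.comp_apply,
        TensorProduct.comul_tmul]
      simp only [LinearMap.comp_apply] at e1 e2
      rw [e1, e2, ← (ℛ k x).eq, ← (ℛ k y).eq]
      simp [TensorProduct.sum_tmul, TensorProduct.tmul_sum, tensorPairing_tmul, Finset.sum_mul_sum,
        mul_mul_mul_comm]
      exact Finset.sum_comm

theorem IsHopfPairing.flip (hB : IsHopfPairing B) : IsHopfPairing B.flip where
  one_left := hB.one_right
  one_right := hB.one_left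
  mul_left x y a := by rw [tensorPairing_flip]; exact hB.mul_right a x y
  mul_right x a b := by rw [tensorPairing_flip]; exact hB.mul_left a b x

/-- As forms on A ⊗ A', the left side is a left convolution inverse of B and the right side a right
one, so they coincide. -/
theorem IsHopfPairing.antipode (hB : IsHopfPairing B) (a : A) (x : A') :
    B (HopfAlgebra.antipode k a) x = B a (HopfAlgebra.antipode k x) := by
  let F : WithConv (A ⊗[k] A' →ₗ[k] k) := toConv (TensorProduct.lift B)
  let P : WithConv (A ⊗[k] A' →ₗ[k] k) :=
    toConv (TensorProduct.lift (B ∘ₗ HopfAlgebra.antipode k))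
  let Q : WithConv (A ⊗[k] A' →ₗ[k] k) :=
    toConv (TensorProduct.lift (B.compl₂ (HopfAlgebra.antipode k)))
  have hP : P * F = 1 := by
    apply WithConv.ext
    ext a x
    have e := congrArg (fun b => B b x) (HopfAlgebra.sum_antipode_mul_eq_algebraMap_counit (ℛ k a))
    simp only [map_sum, LinearMap.sum_apply, hB.mul_left, Algebra.algebraMap_eq_smul_one, map_smul,
      LinearMap.smul_apply, hB.one_left] at e
    refine Eq.trans ?_ (e.trans ?_)
    · simp only [LinearMap.convMul_def, TensorProduct.AlgebraTensorModule.curry_apply,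
        LinearMap.restrictScalars_self, TensorProduct.curry_apply, LinearMap.comp_apply,
        TensorProduct.comul_tmul]
      rw [← (ℛ k a).eq, ← (ℛ k x).eq]
      simp [TensorProduct.sum_tmul, TensorProduct.tmul_sum, tensorPairing_tmul, P, F]
      exact Finset.sum_comm
    · simp [LinearMap.convOne_def, mul_comm]
  have hQ : F * Q = 1 := by
    apply WithConv.ext
    ext a x
    have e := congrArg (fun b => B a b) (HopfAlgebra.sum_mul_antipode_eq_algebraMap_counit (ℛ k x))
    simp only [map_sum, hB.mul_right, Algebra.algebraMap_eq_smul_one, map_smul, hB.one_right] at e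
    refine Eq.trans ?_ (e.trans ?_)
    · simp only [LinearMap.convMul_def, TensorProduct.AlgebraTensorModule.curry_apply,
        LinearMap.restrictScalars_self, TensorProduct.curry_apply, LinearMap.comp_apply,
        TensorProduct.comul_tmul]
      rw [← (ℛ k a).eq, ← (ℛ k x).eq]
      simp [TensorProduct.sum_tmul, TensorProduct.tmul_sum, tensorPairing_tmul, Q, F]
    · simp [LinearMap.convOne_def, mul_comm]
  have := congrArg (fun f => f.ofConv (a ⊗ₜ[k] x)) (left_inv_eq_right_inv hP hQ)
  simpa [P, Q] using this

/-- The left radical of a Hopf pairing. -/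
def IsHopfPairing.radical (hB : IsHopfPairing B) : Ideal A where
  carrier := {a | ∀ x, B a x = 0}
  zero_mem' := by simp
  add_mem' ha hb x := by rw [map_add, LinearMap.add_apply, ha x, hb x, add_zero]
  smul_mem' c a ha x := by
    rw [smul_eq_mul, hB.mul_left, ← (ℛ k x).eq]
    simp [tensorPairing_tmul, show ∀ y, B a y = 0 from ha]

namespace IsHopfPairing

variable (hB : IsHopfPairing B)

theorem mem_radical {a : A} : a ∈ hB.radical ↔ ∀ x, B a x = 0 := Iff.rfl

instance : hB.radical.IsTwoSided where
  mul_mem_of_left b ha x := by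
    rw [hB.mul_left, ← (ℛ k x).eq]
    simp [tensorPairing_tmul, hB.mem_radical.1 ha]

/-- For the coideal condition, the pairing induced on the quotient by the radical has no left
radical, hence neither has its tensor square. The image of Δ(a) in that square pairs with x ⊗ y to
B(a, xy) = 0. -/
instance : hB.radical.IsHopfIdeal k where
  counit_eq_zero a ha := by rw [← hB.one_right]; exact ha 1
  map_mkQ_comul_eq_zero a ha := by
    let R := hB.radical.restrictScalars k
    let D : A ⧸ R →ₗ[k] A' →ₗ[k] k := R.liftQ B fun b hb => LinearMap.ext hb
    refine eq_zero_of_tensorPairing D (fun b hb => ?_) fun x y => ?_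
    · obtain ⟨b, rfl⟩ := R.mkQ_surjective b
      exact (Submodule.Quotient.mk_eq_zero R).2 hb
    · have := tensorPairing_map B D R.mkQ LinearMap.id (fun _ _ => rfl) (comul (R := k) a)
        (x ⊗ₜ[k] y)
      rw [TensorProduct.map_id, LinearMap.id_apply] at this
      rw [this, ← hB.mul_right]
      exact ha _
  antipode_mem a ha x := by rw [hB.antipode]; exact ha _

/-- A Hopf ideal that pairs to zero with two elements pairs to zero with their product. -/
theorem mul_right_eq_zero (hB : IsHopfPairing B) (I : Ideal A) (hI : I.IsHopfIdeal k) {x y : A'}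
    (hx : ∀ a ∈ I, B a x = 0) (hy : ∀ a ∈ I, B a y = 0) {a : A} (ha : a ∈ I) :
    B a (x * y) = 0 := by
  let R := I.restrictScalars k
  -- Both forms factor through the quotient by I, and the image of Δ(a) in the tensor square of that
  -- quotient is zero.
  let f := R.liftQ (B.flip x) hx
  let g := R.liftQ (B.flip y) hy
  have h : ∀ t : A ⊗[k] A, tensorPairing B t (x ⊗ₜ[k] y) =
      LinearMap.mul' k k (TensorProduct.map f g (TensorProduct.map R.mkQ R.mkQ t)) := fun t => by
    induction t using TensorProduct.induction_on with
    | zero => simp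
    | add s s' hs hs' => simp only [map_add, LinearMap.add_apply, hs, hs']
    | tmul a b => rfl
  rw [hB.mul_right, h, hI.map_mkQ_comul_eq_zero ha, map_zero, map_zero]

/-- A Hopf pairing induces a nondegenerate Hopf pairing of the quotients by its radicals. -/
theorem exists_quotient (hB : IsHopfPairing B) (I : Ideal A) (I' : Ideal A') [I.IsTwoSided] [I'.IsTwoSided]
    [I.IsHopfIdeal k] [I'.IsHopfIdeal k] (hI : ∀ a, a ∈ I ↔ ∀ x, B a x = 0)
    (hI' : ∀ x, x ∈ I' ↔ ∀ a, B a x = 0) :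
    ∃ D : A ⧸ I →ₗ[k] A' ⧸ I' →ₗ[k] k, IsHopfPairing D ∧
      (∀ a x, D (Ideal.Quotient.mk I a) (Ideal.Quotient.mk I' x) = B a x) ∧
      (∀ a, (∀ x, D a x = 0) → a = 0) ∧ (∀ x, (∀ a, D a x = 0) → x = 0) := by
  -- Arbitrary linear sections of the two quotient maps: changing a lift moves it within a radical
  -- and does not change the value of B.
  obtain ⟨s, hs⟩ := (Ideal.Quotient.mkₐ k I).toLinearMap.exists_rightInverse_of_surjective
    (LinearMap.range_eq_top.2 Ideal.Quotient.mk_surjective)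
  obtain ⟨s', hs'⟩ := (Ideal.Quotient.mkₐ k I').toLinearMap.exists_rightInverse_of_surjective
    (LinearMap.range_eq_top.2 Ideal.Quotient.mk_surjective)
  let D : A ⧸ I →ₗ[k] A' ⧸ I' →ₗ[k] k := B.compl₁₂ s s'
  have hD : ∀ a x, D (Ideal.Quotient.mk I a) (Ideal.Quotient.mk I' x) = B a x := fun a x => by
    have e : s (Ideal.Quotient.mk I a) - a ∈ I :=
      Ideal.Quotient.eq.1 (LinearMap.congr_fun hs (Ideal.Quotient.mk I a))
    have e' : s' (Ideal.Quotient.mk I' x) - x ∈ I' :=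
      Ideal.Quotient.eq.1 (LinearMap.congr_fun hs' (Ideal.Quotient.mk I' x))
    have h1 := (hI _).1 e (s' (Ideal.Quotient.mk I' x))
    have h2 := (hI' _).1 e' a
    rw [map_sub, LinearMap.sub_apply, sub_eq_zero] at h1
    rw [map_sub, sub_eq_zero] at h2
    exact h1.trans h2
  have hT := tensorPairing_map B D (Ideal.Quotient.mkₐ k I).toLinearMap
    (Ideal.Quotient.mkₐ k I').toLinearMap hD
  refine ⟨D, ⟨?_, ?_, ?_, ?_⟩, hD, ?_, ?_⟩
  · rintro ⟨x⟩
    exact (hD 1 x).trans (hB.one_left x)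
  · rintro ⟨a⟩
    exact (hD a 1).trans (hB.one_right a)
  · rintro ⟨a⟩ ⟨b⟩ ⟨x⟩
    exact (hD (a * b) x).trans ((hB.mul_left a b x).trans (hT (a ⊗ₜ b) (comul x)).symm)
  · rintro ⟨a⟩ ⟨x⟩ ⟨y⟩
    exact (hD a (x * y)).trans ((hB.mul_right a x y).trans (hT (comul a) (x ⊗ₜ y)).symm)
  · rintro ⟨a⟩ h
    exact Ideal.Quotient.eq_zero_iff_mem.2 ((hI a).2 fun x =>
      (hD a x).symm.trans (h (Ideal.Quotient.mk I' x)))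
  · rintro ⟨x⟩ h
    exact Ideal.Quotient.eq_zero_iff_mem.2 ((hI' x).2 fun a =>
      (hD a x).symm.trans (h (Ideal.Quotient.mk I a)))

end IsHopfPairing

end Pairing

/-! ### The components of degree zero and one of `T(V) # H`, and the Nichols ideal as a radical. -/

namespace YDModule

open Coalgebra

variable {k : Type u} {H : Type v} {V : Type w} [Field k] [Ring H] [HopfAlgebra k H]
    [AddCommGroup V] [Module k V] (M : YDModule k H V)

namespace TensorBosonization

/-- The projection `T(V) # H → H`. -/
def projH : M.TensorBosonization →ₐ[k] H :=
  lift M (AlgHom.id k H) 0 fun h v => by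
    rw [← (ℛ k h).eq]
    simp

@[simp] theorem projH_ιH (h : H) : projH M (ιH M h) = h := by simp [projH]

@[simp] theorem projH_ιV (v : V) : projH M (ιV M v) = 0 := by simp [projH]

/-- The action of `H` on `V ⊕ k`, on `k` by `ε`. -/
def derActH : H →ₐ[k] Module.End k (V × k) :=
  AlgHom.ofLinearMap
    { toFun := fun h => (M.act h).prodMap (counit (R := k) h • LinearMap.id)
      map_add' := fun h h' => by ext <;> simp [add_smul]
      map_smul' := fun c h => by ext <;> simp [mul_smul] }
    (by ext <;> simp) (fun h h' => by ext <;> simp)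

/-- The endomorphisms `(w, c) ↦ (c v, 0)` of `V ⊕ k`. -/
def derActV (k : Type u) (V : Type w) [Field k] [AddCommGroup V] [Module k V] :
    V →ₗ[k] Module.End k (V × k) where
  toFun v := LinearMap.inl k V k ∘ₗ LinearMap.toSpanSingleton k V v ∘ₗ LinearMap.snd k V k
  map_add' v w := by ext <;> simp
  map_smul' c v := by ext <;> simp

theorem derActH_apply (h : H) (p : V × k) :
    derActH M h p = (M.act h p.1, counit (R := k) h * p.2) := rfl

theorem derActV_apply (v : V) (p : V × k) : derActV k V v p = (p.2 • v, 0) := rfl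

theorem derAct_cross (h : H) (v : V) : derActH M h * derActV k V v =
    LinearMap.mul' k _ (TensorProduct.map (derActV k V ∘ₗ M.act.toLinearMap.flip v)
      (derActH M).toLinearMap (comul (R := k) h)) := by
  have e := congrArg (fun h => M.act h v) (sum_counit_smul_right (k := k) h)
  simp only [map_sum, map_smul, LinearMap.sum_apply, LinearMap.smul_apply] at e
  conv_rhs => rw [← (ℛ k h).eq]
  refine LinearMap.ext fun p => ?_
  simp only [map_sum, TensorProduct.map_tmul, LinearMap.mul'_apply, LinearMap.sum_apply,
    Module.End.mul_apply, derActH_apply, derActV_apply, LinearMap.comp_apply,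
    AlgHom.toLinearMap_apply, LinearMap.flip_apply, map_smul, mul_zero]
  ext
  · simp only [Prod.fst_sum, ← e, Finset.smul_sum, smul_smul]
    exact Finset.sum_congr rfl fun i _ => by rw [mul_comm]
  · simp [Prod.snd_sum]

/-- The action of `T(V) # H` on `V ⊕ k` in which `H` acts on `V` and, by `ε`, on `k`, and `v ∈ V`
maps `(w, c)` to `(c v, 0)`. -/
def derAct : M.TensorBosonization →ₐ[k] Module.End k (V × k) :=
  lift M (derActH M) (derActV k V) (derAct_cross M)

/-- The projection `T(V) # H → V ⊗ H → V` onto the elements of degree one, followed by `id ⊗ ε`. -/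
def der : M.TensorBosonization →ₗ[k] V :=
  LinearMap.fst k V k ∘ₗ (derAct M).toLinearMap.flip (0, 1)

/-- The action on V ⊕ k is block triangular: the diagonal entries are the action of π(a), with π =
`projH`, and the scalar ε(a); the off-diagonal entry is `der`. The Leibniz rule for `der` is the
multiplication of such matrices. -/
theorem derAct_apply (a : M.TensorBosonization) (p : V × k) :
    derAct M a p = (M.act (projH M a) p.1 + p.2 • der M a, p.2 * counit (R := k) a) := by
  induction a using induction generalizing p with
  | hH h => simp [der, derAct, derActH_apply, mul_comm]
  | hV v => simp [der, derAct, derActV_apply]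
  | hmul a b ha hb =>
    have e : der M (a * b) = M.act (projH M a) (der M b) + counit (R := k) b • der M a := by
      change (derAct M (a * b) (0, 1)).1 = _
      rw [map_mul, Module.End.mul_apply, hb, ha]
      simp
    rw [map_mul, Module.End.mul_apply, hb, ha, e]
    ext
    · simp [smul_smul, add_assoc]
    · simp [mul_comm, mul_left_comm]
  | hadd a b ha hb =>
    rw [map_add, LinearMap.add_apply, ha, hb]
    ext
    · simp; abel
    · simp [mul_add]

@[simp] theorem der_ιH (h : H) : der M (ιH M h) = 0 := by simp [der, derAct, derActH_apply]

@[simp] theorem der_ιV (v : V) : der M (ιV M v) = v := by simp [der, derAct, derActV_apply]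

theorem der_mul (a b : M.TensorBosonization) :
    der M (a * b) = M.act (projH M a) (der M b) + counit (R := k) b • der M a := by
  change (derAct M (a * b) (0, 1)).1 = _
  rw [map_mul, Module.End.mul_apply, derAct_apply, derAct_apply]
  simp

@[simp] theorem der_one : der M 1 = 0 := by
  rw [← map_one (ιH M), der_ιH]

/-- The component of degree one of `T(V) # H`, as an element of `V ⊗ H`. -/
def degreeOne : M.TensorBosonization →ₗ[k] V ⊗[k] H :=
  TensorProduct.map (der M) (projH M).toLinearMap ∘ₗ comul

/-- In Δ(v)Δ(b) the summand coming from v₍₋₁₎ ⊗ v₍₀₎ dies because π kills v₍₀₎. In the other one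
`der` leaves ε(b₍₁₎) v, and the counit collapses the sum. In particular vh is sent to v ⊗ h. -/
theorem degreeOne_ιV_mul (v : V) (b : M.TensorBosonization) :
    degreeOne M (ιV M v * b) = v ⊗ₜ[k] projH M b := by
  -- Since π is multiplicative, it may be applied to the second tensor factors before multiplying,
  -- so a left factor s killed by id ⊗ π contributes nothing.
  have h : ∀ s t : M.TensorBosonization ⊗[k] M.TensorBosonization,
      (projH M).toLinearMap.lTensor _ s = 0 →
      TensorProduct.map (der M) (projH M).toLinearMap (s * t) = 0 := by
    intro s t hs
    have e : TensorProduct.map (der M) (projH M).toLinearMap (s * t) =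
        (der M).rTensor H ((projH M).toLinearMap.lTensor _ s *
          (projH M).toLinearMap.lTensor _ t) := by
      clear hs
      induction s using TensorProduct.induction_on with
      | zero => simp
      | add s s' hs hs' => simp only [add_mul, map_add, hs, hs']
      | tmul a b =>
        induction t using TensorProduct.induction_on with
        | zero => simp
        | add t t' ht ht' => simp only [mul_add, map_add, ht, ht']
        | tmul x y => simp
    rw [e, hs, zero_mul, map_zero]
  have e := congrArg (projH M) (sum_counit_smul (ℛ k b))
  simp only [map_sum, map_smul] at e
  rw [degreeOne, LinearMap.comp_apply, Bialgebra.comul_mul, comul_ιV, add_mul, map_add,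
    h (TensorProduct.map _ _ _) _ ?_, add_zero]
  · conv_lhs => rw [← (ℛ k b).eq]
    simp [Finset.mul_sum, der_mul, ← e, TensorProduct.tmul_sum, TensorProduct.smul_tmul]
  · obtain ⟨S, hS⟩ := TensorProduct.exists_finset (M.coact v)
    simp [hS]

@[simp] theorem degreeOne_ιH (h : H) : degreeOne M (ιH M h) = 0 := by
  rw [degreeOne, LinearMap.comp_apply, comul_ιH, ← (ℛ k h).eq]
  simp

theorem tensorComponent_zero : M.tensorComponent 0 = LinearMap.range (ιH M).toLinearMap := by
  simp [tensorComponent]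

theorem tensorComponent_succ (m : ℕ) :
    M.tensorComponent (m + 1) = LinearMap.range (ιV M) * M.tensorComponent m := by
  simp [tensorComponent, pow_succ', mul_assoc]

theorem range_ιH_mul_range_ιV : LinearMap.range (ιH M).toLinearMap * LinearMap.range (ιV M) ≤
    LinearMap.range (ιV M) * LinearMap.range (ιH M).toLinearMap := by
  rw [Submodule.mul_le]
  rintro _ ⟨h, rfl⟩ _ ⟨v, rfl⟩
  rw [AlgHom.toLinearMap_apply, cross']
  exact Submodule.sum_mem _ fun i _ => Submodule.mul_mem_mul ⟨_, rfl⟩ ⟨_, rfl⟩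

theorem tensorComponent_mul (m p : ℕ) :
    M.tensorComponent m * M.tensorComponent p ≤ M.tensorComponent (m + p) := by
  have hH : LinearMap.range (ιH M).toLinearMap * LinearMap.range (ιH M).toLinearMap ≤
      LinearMap.range (ιH M).toLinearMap := by
    rw [Submodule.mul_le]
    rintro _ ⟨h, rfl⟩ _ ⟨h', rfl⟩
    exact ⟨h * h', map_mul (ιH M) h h'⟩
  have h0 : ∀ p, LinearMap.range (ιH M).toLinearMap * M.tensorComponent p ≤
      M.tensorComponent p := by
    intro p
    induction p with
    | zero => simpa [tensorComponent_zero] using hH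
    | succ p ih =>
      rw [tensorComponent_succ, ← mul_assoc]
      refine (mul_le_mul_left (range_ιH_mul_range_ιV M) _).trans ?_
      rw [mul_assoc]
      exact mul_le_mul_right ih _
  induction m with
  | zero => simpa [tensorComponent_zero] using h0 p
  | succ m ih =>
    rw [Nat.add_right_comm, tensorComponent_succ, tensorComponent_succ, mul_assoc]
    exact mul_le_mul_right ih _

theorem iSup_tensorComponent : ⨆ m, M.tensorComponent m = ⊤ := by
  rw [eq_top_iff]
  rintro a -
  induction a using induction with
  | hH h =>
    refine Submodule.mem_iSup_of_mem 0 ?_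
    rw [tensorComponent_zero]
    exact ⟨h, rfl⟩
  | hV v =>
    refine Submodule.mem_iSup_of_mem 1 ?_
    rw [tensorComponent_succ, tensorComponent_zero, ← mul_one (ιV M v)]
    exact Submodule.mul_mem_mul ⟨v, rfl⟩ ⟨1, map_one (ιH M)⟩
  | hmul a b ha hb =>
    have := Submodule.mul_mem_mul ha hb
    rw [Submodule.iSup_mul] at this
    have hle : ⨆ m, M.tensorComponent m * ⨆ p, M.tensorComponent p ≤
        ⨆ m, M.tensorComponent m := iSup_le fun m => by
      rw [Submodule.mul_iSup]
      exact iSup_le fun p => (tensorComponent_mul M m p).trans (le_iSup M.tensorComponent (m + p))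
    exact hle this
  | hadd a b ha hb => exact Submodule.add_mem _ ha hb

theorem projH_eq_zero {a : M.TensorBosonization} {m : ℕ} (ha : a ∈ M.tensorComponent (m + 1)) :
    projH M a = 0 := by
  rw [tensorComponent_succ] at ha
  induction ha using Submodule.mul_induction_on' with
  | mem_mul_mem x hx y _ => obtain ⟨v, rfl⟩ := hx; simp
  | add x _ y _ hx hy => rw [map_add, hx, hy, add_zero]

theorem counit_eq_counit_projH (a : M.TensorBosonization) :
    counit (R := k) a = counit (R := k) (projH M a) := by
  have : Bialgebra.counitAlgHom k M.TensorBosonization =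
      (Bialgebra.counitAlgHom k H).comp (projH M) := by
    ext <;> simp
  exact DFunLike.congr_fun this a

/-- On vb with b of positive degree, `projH` vanishes because it kills v, while `der` and
`degreeOne` see b only through ε(b) and π(b), both of which are zero. -/
theorem degreeTwo_vanish {a : M.TensorBosonization}
    (ha : a ∈ ⨆ m : ℕ, ⨆ _ : 2 ≤ m, M.tensorComponent m) :
    projH M a = 0 ∧ der M a = 0 ∧ degreeOne M a = 0 := by
  suffices h : ⨆ m : ℕ, ⨆ _ : 2 ≤ m, M.tensorComponent m ≤
      LinearMap.ker (projH M).toLinearMap ⊓ (LinearMap.ker (der M) ⊓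
        LinearMap.ker (degreeOne M)) by simpa using h ha
  refine iSup₂_le fun m hm => ?_
  obtain ⟨m, rfl⟩ := Nat.exists_eq_add_of_le' hm
  rw [tensorComponent_succ, Submodule.mul_le]
  rintro _ ⟨v, rfl⟩ b hb
  have := projH_eq_zero M hb
  simp [degreeOne_ιV_mul, der_mul, this, counit_eq_counit_projH M b]

/-- Split a into parts of degree zero, one and at least two. The projection to H reads off the first
part, and v ⊗ h ↦ vh recovers the second from `degreeOne`, so both are zero. Directness of the
decomposition is not needed. -/
theorem mem_degreeTwo {a : M.TensorBosonization} (ha : projH M a = 0) (ha' : degreeOne M a = 0) :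
    a ∈ ⨆ m : ℕ, ⨆ _ : 2 ≤ m, M.tensorComponent m := by
  have hle : (⊤ : Submodule k M.TensorBosonization) ≤ M.tensorComponent 0 ⊔
      (M.tensorComponent 1 ⊔ ⨆ m : ℕ, ⨆ _ : 2 ≤ m, M.tensorComponent m) := by
    rw [← iSup_tensorComponent]
    refine iSup_le fun m => ?_
    match m with
    | 0 => exact le_sup_left
    | 1 => exact le_sup_left.trans le_sup_right
    | m + 2 =>
      exact (le_iSup₂_of_le (f := fun (m : ℕ) (_ : 2 ≤ m) => M.tensorComponent m) (m + 2)
        (by omega) le_rfl).trans (le_sup_right.trans le_sup_right)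
  obtain ⟨a₀, h₀, b, hb, rfl⟩ := Submodule.mem_sup.1 (hle (Submodule.mem_top (x := a)))
  obtain ⟨a₁, h₁, a₂, h₂, rfl⟩ := Submodule.mem_sup.1 hb
  rw [tensorComponent_zero] at h₀
  obtain ⟨h, rfl⟩ := h₀
  obtain ⟨e₁, -, e₂⟩ := degreeTwo_vanish M h₂
  have hh : h = 0 := by simpa [e₁, projH_eq_zero M h₁] using ha
  subst hh
  have key : ∀ c ∈ M.tensorComponent 1, LinearMap.mul' k _ (TensorProduct.map (ιV M)
      (ιH M).toLinearMap (degreeOne M c)) = c := by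
    intro c hc
    rw [tensorComponent_succ, tensorComponent_zero] at hc
    induction hc using Submodule.mul_induction_on' with
    | mem_mul_mem x hx y hy =>
      obtain ⟨v, rfl⟩ := hx
      obtain ⟨h, rfl⟩ := hy
      simp [degreeOne_ιV_mul]
    | add x _ y _ hx hy => simp only [map_add, hx, hy]
  have := key a₁ h₁
  simp [e₂] at ha'
  rw [ha', map_zero, map_zero] at this
  simpa [← this] using h₂

end TensorBosonization

open TensorBosonization

variable {H' : Type*} {V' : Type*} [Ring H'] [HopfAlgebra k H']
    [AddCommGroup V'] [Module k V'] (M' : YDModule k H' V')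

/-- A Hopf pairing of `T(V) # H` with `T(V') # H'` that is nondegenerate in the degrees zero and
one has the ideal of the Nichols algebra as its left radical. -/
theorem mem_nicholsIdeal_iff {B : M.TensorBosonization →ₗ[k] M'.TensorBosonization →ₗ[k] k}
    (hB : IsHopfPairing B) (hH : ∀ a, (∀ h, B a (ιH M' h) = 0) ↔ projH M a = 0)
    (hV : ∀ a, (∀ v, B a (ιV M' v) = 0) ↔ der M a = 0) (a : M.TensorBosonization) :
    a ∈ M.nicholsIdeal ↔ ∀ x, B a x = 0 := by
  constructor
  · intro ha
    suffices h : M.nicholsIdeal ≤ hB.radical from h ha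
    refine sSup_le fun I ⟨_, hI, hI'⟩ => ?_
    -- The elements orthogonal to I are closed under products because I is a coideal. They contain
    -- H' and V' because pairing with these sees only `projH` and `der`, which vanish in degrees at
    -- least two.
    have key : ∀ x, ∀ b ∈ I, B b x = 0 := fun x => by
      induction x using TensorBosonization.induction with
      | hH h => exact fun b hb => (hH b).2 (degreeTwo_vanish M (hI' hb)).1 h
      | hV v => exact fun b hb => (hV b).2 (degreeTwo_vanish M (hI' hb)).2.1 v
      | hmul x y hx hy => exact fun b hb => hB.mul_right_eq_zero I hI hx hy hb
      | hadd x y hx hy => exact fun b hb => by rw [map_add, hx b hb, hy b hb, add_zero]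
    exact fun b hb x => key x b hb
  · intro ha
    have hle : hB.radical ≤ M.nicholsIdeal := by
      refine le_sSup ⟨inferInstance, inferInstance, fun b hb => mem_degreeTwo M ?_ ?_⟩
      · exact (hH b).1 fun h => hb _
      -- Both `der` and `projH` kill the radical, so `degreeOne`, which is (der ⊗ π) ∘ Δ, factors
      -- through the image of Δ in the tensor square of the quotient. That image is zero on the
      -- radical.
      · let R := hB.radical.restrictScalars k
        let p := R.liftQ (projH M).toLinearMap fun c hc => (hH c).1 fun h => hc _
        let d := R.liftQ (der M) fun c hc => (hV c).1 fun h => hc _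
        have hc : TensorProduct.map R.mkQ R.mkQ (comul (R := k) b) = 0 :=
          (inferInstance : hB.radical.IsHopfIdeal k).map_mkQ_comul_eq_zero hb
        have e : degreeOne M b = TensorProduct.map d p (TensorProduct.map R.mkQ R.mkQ
            (comul (R := k) b)) := by
          rw [← LinearMap.comp_apply, ← TensorProduct.map_comp]
          rfl
        rw [e, hc, map_zero]
    exact hle ha

end YDModule

namespace YDModule.TensorBosonization

open Coalgebra

variable {k : Type u} {H : Type v} {V : Type w} [Field k] [Ring H] [HopfAlgebra k H]
    [AddCommGroup V] [Module k V] (M : YDModule k H V)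

/-- Compatibility of π with Δ makes pullback along π carry products of functions on the group to
convolution products of forms, as `formH` requires. -/
theorem map_projH_comul (a : M.TensorBosonization) :
    TensorProduct.map (projH M).toLinearMap (projH M).toLinearMap (comul (R := k) a) =
      comul (R := k) (projH M a) := by
  have : (Algebra.TensorProduct.map (projH M) (projH M)).comp
      (Bialgebra.comulAlgHom k M.TensorBosonization) =
      (Bialgebra.comulAlgHom k H).comp (projH M) := by
    refine hom_ext (AlgHom.ext fun h => ?_) (LinearMap.ext fun v => ?_)
    · change TensorProduct.map (projH M).toLinearMap (projH M).toLinearMap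
        (comul (R := k) (ιH M h)) = comul (R := k) (projH M (ιH M h))
      rw [comul_ιH, projH_ιH, ← LinearMap.comp_apply, ← TensorProduct.map_comp,
        ← AlgHom.comp_toLinearMap]
      have : (projH M).comp (ιH M) = AlgHom.id k H := AlgHom.ext fun h => projH_ιH M h
      simp [this]
    · change TensorProduct.map (projH M).toLinearMap (projH M).toLinearMap
        (comul (R := k) (ιV M v)) = comul (R := k) (projH M (ιV M v))
      obtain ⟨S, hS⟩ := TensorProduct.exists_finset (M.coact v)
      simp [hS]
  exact DFunLike.congr_fun this a

/-- Left multiplication by the generators generates. -/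
theorem induction_left {C : M.TensorBosonization → Prop} (one : C 1)
    (hH : ∀ h a, C a → C (ιH M h * a)) (hV : ∀ v a, C a → C (ιV M v * a))
    (hadd : ∀ a b, C a → C b → C (a + b)) (a) : C a := by
  suffices h : ∀ b, C b → C (a * b) by simpa using h 1 one
  induction a using induction with
  | hH h => exact hH h
  | hV v => exact hV v
  | hmul a b ha hb => exact fun c hc => by rw [mul_assoc]; exact ha _ (hb _ hc)
  | hadd a b ha hb => exact fun c hc => by rw [add_mul]; exact hadd _ _ (ha _ hc) (hb _ hc)

end YDModule.TensorBosonization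

/-! ### The Hopf pairing of T(V) # k^{S_n} with T(V^*) # k S_n, and its radicals. -/

section Duality

open YDModule TensorBosonization FunctionAlgebra Transposition Coalgebra WithConv

section Group

variable (k : Type u) {G : Type v} [Field k] [Fintype G]

/-- The evaluation pairing of `k^G` with `k G`. -/
def evalPairing : FunctionAlgebra k G →ₗ[k] MonoidAlgebra k G →ₗ[k] k :=
  LinearMap.mk₂ k (fun φ z => ∑ g, eval g φ * z.coeff g)
    (fun φ φ' z => by simp [add_mul, Finset.sum_add_distrib])
    (fun c φ z => by simp [Finset.mul_sum, mul_assoc])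
    (fun φ z z' => by simp [mul_add, Finset.sum_add_distrib])
    (fun c φ z => by simp [Finset.mul_sum, mul_left_comm])

theorem evalPairing_apply (φ : FunctionAlgebra k G) (z : MonoidAlgebra k G) :
    evalPairing k φ z = ∑ g, eval g φ * z.coeff g := rfl

@[simp] theorem evalPairing_single (φ : FunctionAlgebra k G) (g : G) (c : k) :
    evalPairing k φ (MonoidAlgebra.single g c) = eval g φ * c := by
  rw [evalPairing_apply, Finset.sum_eq_single g] <;> simp +contextual [eq_comm]

theorem evalPairing_mul (φ ψ : FunctionAlgebra k G) (z : MonoidAlgebra k G) :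
    evalPairing k (φ * ψ) z = LinearMap.mul' k k (TensorProduct.map (evalPairing k φ)
      (evalPairing k ψ) (comul (R := k) z)) := by
  induction z using MonoidAlgebra.induction_linear with
  | zero => simp
  | add z z' h h' => simp only [map_add, h, h']
  | single g c => simp [mul_assoc]

variable [Group G] [DecidableEq G]

theorem evalPairing_δ (g : G) (z : MonoidAlgebra k G) : evalPairing k (δ k g) z = z.coeff g := by
  simp [evalPairing_apply]

theorem evalPairing_mul_right (φ : FunctionAlgebra k G) (z z' : MonoidAlgebra k G) :
    evalPairing k φ (z * z') = tensorPairing (evalPairing k) (comul (R := k) φ) (z ⊗ₜ z') := by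
  induction z using MonoidAlgebra.induction_linear with
  | zero => simp
  | add z z' h h' => simp only [map_add, h, h', add_mul, TensorProduct.add_tmul]
  | single g c =>
    induction z' using MonoidAlgebra.induction_linear with
    | zero => simp
    | add z z' h h' => simp only [map_add, h, h', mul_add, TensorProduct.tmul_add]
    | single g' c' =>
      simp [comul_apply, LinearMap.sum_apply, tensorPairing_tmul, MonoidAlgebra.single_mul_single,
        Finset.sum_ite_eq]

end Group

/-- The pairing of `V` with `V^*`. -/
def dot (k : Type u) [Field k] (n : ℕ) :
    (Transposition n →₀ k) →ₗ[k] (Transposition n →₀ k) →ₗ[k] k :=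
  LinearMap.mk₂ k (fun v w => ∑ η, v η * w η)
    (fun v v' w => by simp [add_mul, Finset.sum_add_distrib])
    (fun c v w => by simp [Finset.mul_sum, mul_assoc])
    (fun v w w' => by simp [mul_add, Finset.sum_add_distrib])
    (fun c v w => by simp [Finset.mul_sum, mul_left_comm])

variable (k : Type u) [Field k] (n : ℕ)

variable {n} in
theorem dot_single (η : Transposition n) (w : Transposition n →₀ k) :
    dot k n (Finsupp.single η 1) w = w η := by
  change ∑ τ, Finsupp.single η (1 : k) τ * w τ = _
  rw [Finset.sum_eq_single η] <;> simp +contextual [eq_comm]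

variable {n} in
theorem dot_single_right (η : Transposition n) (w : Transposition n →₀ k) :
    dot k n w (Finsupp.single η 1) = w η := by
  change ∑ τ, w τ * Finsupp.single η (1 : k) τ = _
  rw [Finset.sum_eq_single η] <;> simp +contextual [eq_comm]

theorem ydFun_act (φ : FunctionAlgebra k (Equiv.Perm (Fin n))) (v : Transposition n →₀ k)
    (τ : Transposition n) : (ydFun k n).act φ v τ = eval τ.1 φ * v τ := by
  induction v using Finsupp.induction_linear with
  | zero => simp
  | add v w hv hw => simp only [map_add, hv, hw, Finsupp.add_apply, mul_add]
  | single η c =>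
    simp only [ydFun, AlgHom.ofLinearMap_apply, LinearMap.coe_mk, AddHom.coe_mk,
      Finsupp.linearCombination_single, Finsupp.smul_apply, smul_eq_mul, Finsupp.single_apply]
    split_ifs with h
    · subst h; simp [mul_comm]
    · simp

theorem ydFun_coact (η : Transposition n) :
    (ydFun k n).coact (Finsupp.single η 1) = ∑ ω : Equiv.Perm (Fin n),
      sgn k ω • (δ k ω ⊗ₜ[k] Finsupp.single (conj ω⁻¹ η) (1 : k)) := by
  simp [ydFun]

theorem ydGroup_act (g : Equiv.Perm (Fin n)) (v : Transposition n →₀ k) (τ : Transposition n) :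
    (ydGroup k n).act (MonoidAlgebra.of k _ g) v τ = sgn k g * v (conj g⁻¹ τ) := by
  induction v using Finsupp.induction_linear with
  | zero => simp
  | add v w hv hw => simp only [map_add, hv, hw, Finsupp.add_apply, mul_add]
  | single η c =>
    have : conj g η = τ ↔ η = conj g⁻¹ τ := by
      constructor
      · rintro rfl; simp [conj_conj, conj_one]
      · rintro rfl; simp [conj_conj, conj_one]
    by_cases h : conj g η = τ <;> simp [ydGroup, Finsupp.single_apply, ← this, h]

theorem ydGroup_coact (η : Transposition n) :
    (ydGroup k n).coact (Finsupp.single η 1) =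
      MonoidAlgebra.of k _ η.1 ⊗ₜ[k] Finsupp.single η (1 : k) := by
  simp [ydGroup]

/-- The linear forms on `T(V^*) # k S_n` given by the elements of `k^{S_n}`. -/
def formH : FunctionAlgebra k (Equiv.Perm (Fin n)) →ₐ[k]
    WithConv ((ydGroup k n).TensorBosonization →ₗ[k] k) :=
  AlgHom.ofLinearMap
    { toFun := fun φ => toConv (evalPairing k φ ∘ₗ (projH (ydGroup k n)).toLinearMap)
      map_add' := fun φ φ' => by rw [map_add, LinearMap.add_comp, toConv_add]
      map_smul' := fun c φ => by rw [map_smul, LinearMap.smul_comp, toConv_smul]; rfl }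
    (by
      apply WithConv.ext
      ext x
      change evalPairing k 1 (projH _ x) = counit (R := k) x
      rw [counit_eq_counit_projH]
      generalize projH _ x = z
      induction z using MonoidAlgebra.induction_linear with
      | zero => simp
      | add z z' h h' => simp only [map_add, h, h']
      | single g c => simp)
    (fun φ ψ => by
      apply WithConv.ext
      ext x
      change evalPairing k (φ * ψ) (projH _ x) = LinearMap.mul' k k (TensorProduct.map
        (evalPairing k φ ∘ₗ (projH _).toLinearMap) (evalPairing k ψ ∘ₗ (projH _).toLinearMap)
          (comul (R := k) x))
      rw [evalPairing_mul, ← map_projH_comul, TensorProduct.map_comp, LinearMap.comp_apply])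

/-- The linear forms on `T(V^*) # k S_n` given by the elements of `V`. -/
def formV : (Transposition n →₀ k) →ₗ[k] WithConv ((ydGroup k n).TensorBosonization →ₗ[k] k) where
  toFun v := toConv (dot k n v ∘ₗ der (ydGroup k n))
  map_add' v w := by rw [map_add, LinearMap.add_comp, toConv_add]
  map_smul' c v := by rw [map_smul, LinearMap.smul_comp, toConv_smul]; rfl

theorem formH_apply (φ : FunctionAlgebra k (Equiv.Perm (Fin n)))
    (x : (ydGroup k n).TensorBosonization) :
    (formH k n φ).ofConv x = evalPairing k φ (projH _ x) := rfl

theorem formV_apply (v : Transposition n →₀ k) (x : (ydGroup k n).TensorBosonization) :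
    (formV k n v).ofConv x = dot k n v (der _ x) := rfl

theorem formH_of_mul (ω g : Equiv.Perm (Fin n)) (x : (ydGroup k n).TensorBosonization) :
    (formH k n (δ k ω)).ofConv (ιH _ (MonoidAlgebra.of k _ g) * x) =
      (formH k n (δ k (g⁻¹ * ω))).ofConv x := by
  rw [formH_apply, formH_apply, map_mul, projH_ιH, evalPairing_δ, evalPairing_δ]
  simp

theorem formV_of_mul (η : Transposition n) (g : Equiv.Perm (Fin n))
    (x : (ydGroup k n).TensorBosonization) :
    (formV k n (Finsupp.single η 1)).ofConv (ιH _ (MonoidAlgebra.of k _ g) * x) =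
      sgn k g * (formV k n (Finsupp.single (conj g⁻¹ η) 1)).ofConv x := by
  rw [formV_apply, formV_apply, dot_single, dot_single, der_mul, projH_ιH, der_ιH, smul_zero,
    add_zero, ydGroup_act]

theorem formH_ιV_mul (φ : FunctionAlgebra k (Equiv.Perm (Fin n))) (v : Transposition n →₀ k)
    (x : (ydGroup k n).TensorBosonization) : (formH k n φ).ofConv (ιV _ v * x) = 0 := by
  rw [formH_apply, map_mul, projH_ιV, zero_mul, map_zero]

theorem formV_ιV_mul (v w : Transposition n →₀ k) (x : (ydGroup k n).TensorBosonization) :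
    (formV k n v).ofConv (ιV _ w * x) = counit (R := k) x * dot k n v w := by
  rw [formV_apply, der_mul, projH_ιV, der_ιV, map_zero, LinearMap.zero_apply, zero_add, map_smul,
    smul_eq_mul]

variable {n}

/-- Induction by left multiplication with the basic generators of `T(V^*) # k S_n`. -/
theorem induction_ydGroup {C : (ydGroup k n).TensorBosonization → Prop} (one : C 1)
    (hH : ∀ g a, C a → C (ιH _ (MonoidAlgebra.of k _ g) * a))
    (hV : ∀ τ a, C a → C (ιV _ (Finsupp.single τ 1) * a))
    (hadd : ∀ a b, C a → C b → C (a + b)) (hsmul : ∀ (c : k) a, C a → C (c • a)) (a) : C a := by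
  have zero : C 0 := by simpa using hsmul 0 1 one
  refine induction_left _ one (fun h a ha => ?_) (fun v a ha => ?_) hadd a
  · induction h using MonoidAlgebra.induction_linear with
    | zero => simpa using zero
    | add h h' i i' => rw [map_add, add_mul]; exact hadd _ _ i i'
    | single g c =>
      have := hsmul c _ (hH g a ha)
      rwa [← smul_mul_assoc, ← map_smul, MonoidAlgebra.of_apply, MonoidAlgebra.smul_single,
        smul_eq_mul, mul_one] at this
  · induction v using Finsupp.induction_linear with
    | zero => simpa using zero
    | add h h' i i' => rw [map_add, add_mul]; exact hadd _ _ i i'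
    | single g c =>
      have := hsmul c _ (hV g a ha)
      rwa [← smul_mul_assoc, ← map_smul, Finsupp.smul_single, smul_eq_mul, mul_one] at this

theorem comul_of_mul (g : Equiv.Perm (Fin n)) (x : (ydGroup k n).TensorBosonization) :
    comul (R := k) (ιH (ydGroup k n) (MonoidAlgebra.of k _ g) * x) =
      ∑ i ∈ (ℛ k x).index, (ιH _ (MonoidAlgebra.of k _ g) * (ℛ k x).left i) ⊗ₜ[k]
        (ιH _ (MonoidAlgebra.of k _ g) * (ℛ k x).right i) := by
  rw [Bialgebra.comul_mul, comul_ιH]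
  conv_lhs => rw [← (ℛ k x).eq]
  simp [Finset.mul_sum]

theorem comul_single_mul (τ : Transposition n) (x : (ydGroup k n).TensorBosonization) :
    comul (R := k) (ιV (ydGroup k n) (Finsupp.single τ 1) * x) =
      ∑ i ∈ (ℛ k x).index, ((ιV _ (Finsupp.single τ 1) * (ℛ k x).left i) ⊗ₜ[k] (ℛ k x).right i +
        (ιH _ (MonoidAlgebra.of k _ τ.1) * (ℛ k x).left i) ⊗ₜ[k]
          (ιV _ (Finsupp.single τ 1) * (ℛ k x).right i)) := by
  rw [Bialgebra.comul_mul, comul_ιV, ydGroup_coact]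
  conv_lhs => rw [← (ℛ k x).eq]
  simp [Finset.mul_sum, add_mul]

/-- This is the relation δ_ω y_η = y_η δ_{η⁻¹ω} among forms, tested on products of generators. The
induction hypothesis is needed for all ω and η, since left multiplication by g replaces them by g⁻¹ω
and g⁻¹ηg and brings out sgn(g) on both sides. Left multiplication by x_τ leaves one surviving term
of the coproduct on each side, and both vanish unless η = τ. -/
theorem form_cross_apply (x : (ydGroup k n).TensorBosonization) :
    ∀ (ω : Equiv.Perm (Fin n)) (η : Transposition n),
    (formH k n (δ k ω) * formV k n (Finsupp.single η 1)).ofConv x =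
      (formV k n (Finsupp.single η 1) * formH k n (δ k (η.1⁻¹ * ω))).ofConv x := by
  induction x using induction_ydGroup k with
  | one =>
    intro ω η
    simp [LinearMap.convMul_def, formV_apply, Algebra.TensorProduct.one_def]
  | hH g x ih =>
    intro ω η
    have e := ih (g⁻¹ * ω) (conj g⁻¹ η)
    have e' : (conj g⁻¹ η).1⁻¹ * (g⁻¹ * ω) = g⁻¹ * (η.1⁻¹ * ω) := by simp [conj, mul_assoc]
    rw [e'] at e
    simp only [LinearMap.convMul_def, LinearMap.comp_apply] at e ⊢
    rw [comul_of_mul]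
    rw [← (ℛ k x).eq] at e
    simp only [map_sum, TensorProduct.map_tmul, LinearMap.mul'_apply, formH_of_mul,
      formV_of_mul] at e ⊢
    simp only [mul_left_comm _ (sgn k g), mul_assoc, ← Finset.mul_sum, e]
  | hV τ x ih =>
    intro ω η
    have e1 := congrArg (formH k n (δ k (τ.1⁻¹ * ω))).ofConv (sum_counit_smul_right (k := k) x)
    have e2 := congrArg (formH k n (δ k (η.1⁻¹ * ω))).ofConv (sum_counit_smul (ℛ k x))
    simp only [map_sum, map_smul, smul_eq_mul] at e1 e2
    simp only [LinearMap.convMul_def, LinearMap.comp_apply]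
    rw [comul_single_mul]
    simp only [map_sum, map_add, TensorProduct.map_tmul, LinearMap.mul'_apply, formH_of_mul,
      formH_ιV_mul, formV_ιV_mul, mul_zero, zero_mul, zero_add, add_zero, dot_single]
    by_cases h : η = τ
    · subst h
      simp only [Finsupp.single_eq_same, mul_one, e2]
      rw [← e1]
      exact Finset.sum_congr rfl fun i _ => mul_comm _ _
    · simp [Ne.symm h]
  | hadd a b ha hb => intro ω η; simp only [map_add, ha ω η, hb ω η]
  | hsmul c a ha => intro ω η; simp only [map_smul, ha ω η]

/-- The hypothesis of the universal property of `T(V) # H`. In Δ(δ_ω) = ∑ δ_g ⊗ δ_{g⁻¹ω} only g = η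
acts nontrivially on y_η, which leaves the relation of `form_cross_apply`. -/
theorem form_cross (φ : FunctionAlgebra k (Equiv.Perm (Fin n))) (v : Transposition n →₀ k) :
    formH k n φ * formV k n v = LinearMap.mul' k _ (TensorProduct.map
      (formV k n ∘ₗ (ydFun k n).act.toLinearMap.flip v) (formH k n).toLinearMap
      (comul (R := k) φ)) := by
  induction v using Finsupp.induction_linear with
  | zero => simp
  | add v w hv hw =>
    simp only [map_add, mul_add, hv, hw, LinearMap.comp_add, TensorProduct.map_add_left,
      LinearMap.add_apply]
  | single η c =>
    have hc : Finsupp.single η c = c • Finsupp.single η (1 : k) := by simp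
    rw [hc]
    simp only [map_smul, mul_smul_comm, LinearMap.comp_smul, TensorProduct.map_smul_left,
      LinearMap.smul_apply]
    congr 1
    rw [← sum_eval φ]
    simp only [map_sum, map_smul, Finset.sum_mul, smul_mul_assoc]
    refine Finset.sum_congr rfl fun ω _ => congrArg _ ?_
    refine (WithConv.ext (LinearMap.ext fun x => form_cross_apply k x ω η)).trans ?_
    rw [comul_δ]
    simp only [map_sum, TensorProduct.map_tmul, LinearMap.mul'_apply, LinearMap.comp_apply,
      LinearMap.flip_apply, AlgHom.toLinearMap_apply]
    have hact : ∀ g, (ydFun k n).act (δ k g) (Finsupp.single η 1) =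
        if η.1 = g then Finsupp.single η 1 else 0 := fun g => by
      ext τ
      rw [ydFun_act, eval_δ]
      by_cases h : η = τ
      · subst h; split_ifs <;> simp
      · split_ifs <;> simp [h]
    rw [Finset.sum_eq_single η.1 (fun g _ hg => by rw [hact, if_neg hg.symm]; simp) (by simp), hact,
      if_pos rfl]

variable (n)

/-- The pairing of `T(V) # k^{S_n}` with `T(V^*) # k S_n`, as an algebra map to the linear forms. -/
def tensorDualityHom : (ydFun k n).TensorBosonization →ₐ[k]
    WithConv ((ydGroup k n).TensorBosonization →ₗ[k] k) :=
  lift _ (formH k n) (formV k n) (form_cross k)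

/-- The pairing of `T(V) # k^{S_n}` with `T(V^*) # k S_n`. -/
def tensorDuality : (ydFun k n).TensorBosonization →ₗ[k]
    (ydGroup k n).TensorBosonization →ₗ[k] k :=
  (WithConv.linearEquiv k _).toLinearMap ∘ₗ (tensorDualityHom k n).toLinearMap

theorem tensorDuality_ιH (φ : FunctionAlgebra k (Equiv.Perm (Fin n)))
    (x : (ydGroup k n).TensorBosonization) :
    tensorDuality k n (ιH _ φ) x = evalPairing k φ (projH _ x) := by
  change (tensorDualityHom k n (ιH _ φ)).ofConv x = _
  rw [tensorDualityHom, lift_ιH, formH_apply]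

theorem tensorDuality_ιV (v : Transposition n →₀ k) (x : (ydGroup k n).TensorBosonization) :
    tensorDuality k n (ιV _ v) x = dot k n v (der _ x) := by
  change (tensorDualityHom k n (ιV _ v)).ofConv x = _
  rw [tensorDualityHom, lift_ιV, formV_apply]

theorem tensorDuality_mul (a b : (ydFun k n).TensorBosonization)
    (x : (ydGroup k n).TensorBosonization) : tensorDuality k n (a * b) x =
      tensorPairing (tensorDuality k n) (a ⊗ₜ[k] b) (comul (R := k) x) := by
  change (tensorDualityHom k n (a * b)).ofConv x = _
  rw [map_mul]
  change LinearMap.mul' k k (TensorProduct.map (tensorDuality k n a) (tensorDuality k n b)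
    (comul (R := k) x)) = _
  rw [← (ℛ k x).eq]
  simp [tensorPairing_tmul]

/-- The action on V^* is the transpose of the coaction on V: at g both give the factor sgn(g) and
the conjugation η ↦ g⁻¹ηg. -/
theorem dot_act (v w : Transposition n →₀ k) (z : MonoidAlgebra k (Equiv.Perm (Fin n))) :
    dot k n v ((ydGroup k n).act z w) = LinearMap.mul' k k (TensorProduct.map
      ((evalPairing k).flip z) ((dot k n).flip w) ((ydFun k n).coact v)) := by
  induction v using Finsupp.induction_linear with
  | zero => simp
  | add v v' hv hv' => simp only [map_add, LinearMap.add_apply, hv, hv']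
  | single η c =>
    have hc : Finsupp.single η c = c • Finsupp.single η (1 : k) := by simp
    rw [hc]
    simp only [map_smul, LinearMap.smul_apply]
    congr 1
    induction z using MonoidAlgebra.induction_linear with
    | zero => simp
    | add z z' hz hz' =>
      simp only [map_add, LinearMap.add_apply, hz, hz', TensorProduct.map_add_left]
    | single g c =>
      have hc : MonoidAlgebra.single g c = c • MonoidAlgebra.of k _ g := by simp
      rw [hc]
      simp only [map_smul, LinearMap.smul_apply, TensorProduct.map_smul_left]
      congr 1
      rw [dot_single, ydGroup_act, ydFun_coact]
      simp [dot_single]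

/-- On k^{S_n} this is the duality of functions with the group algebra. On V the Leibniz rule for
`der` matches Δ(v) = v ⊗ 1 + v₍₋₁₎ ⊗ v₍₀₎ by `dot_act`. Products ab follow because both
comultiplications are multiplicative and pairing with Δ(a)Δ(b) is a convolution product. -/
theorem tensorDuality_mul_right (a : (ydFun k n).TensorBosonization) :
    ∀ x y : (ydGroup k n).TensorBosonization, tensorDuality k n a (x * y) =
      tensorPairing (tensorDuality k n) (comul (R := k) a) (x ⊗ₜ[k] y) := by
  have hH : ∀ (t : FunctionAlgebra k (Equiv.Perm (Fin n)) ⊗[k] FunctionAlgebra k _)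
      (x y : (ydGroup k n).TensorBosonization),
      tensorPairing (tensorDuality k n) (TensorProduct.map (ιH _).toLinearMap
        (ιH _).toLinearMap t) (x ⊗ₜ[k] y) =
      tensorPairing (evalPairing k) t (projH _ x ⊗ₜ[k] projH _ y) := fun t x y => by
    induction t using TensorProduct.induction_on with
    | zero => simp
    | add s s' hs hs' => simp only [map_add, LinearMap.add_apply, hs, hs']
    | tmul φ ψ => simp [tensorPairing_tmul, tensorDuality_ιH]
  have hHV : ∀ (t : FunctionAlgebra k (Equiv.Perm (Fin n)) ⊗[k] (Transposition n →₀ k))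
      (x y : (ydGroup k n).TensorBosonization),
      tensorPairing (tensorDuality k n) (TensorProduct.map (ιH _).toLinearMap
        (ιV _) t) (x ⊗ₜ[k] y) = LinearMap.mul' k k (TensorProduct.map
      ((evalPairing k).flip (projH _ x)) ((dot k n).flip (der _ y)) t) := fun t x y => by
    induction t using TensorProduct.induction_on with
    | zero => simp
    | add s s' hs hs' => simp only [map_add, LinearMap.add_apply, hs, hs']
    | tmul φ v => simp [tensorPairing_tmul, tensorDuality_ιH, tensorDuality_ιV]
  induction a using TensorBosonization.induction with
  | hH φ =>
    intro x y
    rw [comul_ιH, hH, tensorDuality_ιH, map_mul, evalPairing_mul_right]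
  | hV v =>
    intro x y
    rw [tensorDuality_ιV, der_mul, map_add, map_smul, comul_ιV, map_add, LinearMap.add_apply,
      tensorPairing_tmul, tensorDuality_ιV, add_comm, smul_eq_mul, mul_comm]
    · congr 1
      · rw [← map_one (ιH (ydFun k n)), tensorDuality_ιH, ← formH_apply, map_one]
        simp [LinearMap.convOne_def, mul_comm]
      · rw [hHV]
        exact dot_act k n v _ _
  | hmul a b ha hb =>
    intro x y
    have e := congrArg (fun f => f.ofConv (x ⊗ₜ[k] y)) (tensorPairing_mul (tensorDuality_mul k n)
      (comul (R := k) a) (comul (R := k) b))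
    simp only [LinearMap.convMul_def, LinearMap.comp_apply, TensorProduct.comul_tmul] at e
    rw [tensorDuality_mul, Bialgebra.comul_mul, Bialgebra.comul_mul, e, ← (ℛ k x).eq,
      ← (ℛ k y).eq]
    simp only [map_sum, Finset.sum_mul_sum, TensorProduct.sum_tmul, TensorProduct.tmul_sum,
      tensorPairing_tmul, ha, hb, Algebra.TensorProduct.tmul_mul_tmul,
      TensorProduct.AlgebraTensorModule.tensorTensorTensorComm_tmul, TensorProduct.map_tmul,
      LinearMap.mul'_apply]
    exact Finset.sum_comm
  | hadd a b ha hb => intro x y; simp only [map_add, LinearMap.add_apply, ha, hb]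

theorem tensorDuality_isHopfPairing : IsHopfPairing (tensorDuality k n) where
  one_left x := by
    change (tensorDualityHom k n 1).ofConv x = _
    rw [map_one]
    rfl
  one_right a := by
    induction a using TensorBosonization.induction with
    | hH φ => rw [tensorDuality_ιH, map_one, MonoidAlgebra.one_def]; simp
    | hV v => rw [tensorDuality_ιV]; simp
    | hmul a b ha hb =>
      rw [tensorDuality_mul, Bialgebra.comul_one, Algebra.TensorProduct.one_def, tensorPairing_tmul,
        ha, hb, Bialgebra.counit_mul]
    | hadd a b ha hb => rw [map_add, LinearMap.add_apply, ha, hb, map_add]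
  mul_left := tensorDuality_mul k n
  mul_right := tensorDuality_mul_right k n

/-- Pairing with a grouplike element is multiplicative in a, as is evaluating π(a) at g, so it
suffices to compare on generators. -/
theorem tensorDuality_of (a : (ydFun k n).TensorBosonization) (g : Equiv.Perm (Fin n)) :
    tensorDuality k n a (ιH _ (MonoidAlgebra.of k _ g)) = eval g (projH _ a) := by
  induction a using TensorBosonization.induction with
  | hH φ => rw [tensorDuality_ιH]; simp
  | hV v => rw [tensorDuality_ιV]; simp
  | hmul a b ha hb => rw [tensorDuality_mul, comul_ιH]; simp [tensorPairing_tmul, ← ha, ← hb]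
  | hadd a b ha hb => simp only [map_add, LinearMap.add_apply, ha, hb]

/-- From Δ(x_τ) = x_τ ⊗ 1 + τ ⊗ x_τ, pairing with x_τ satisfies the Leibniz rule of the τ-coordinate
of `der`, as functions act on y_τ by their value at τ. -/
theorem tensorDuality_single (a : (ydFun k n).TensorBosonization) (τ : Transposition n) :
    tensorDuality k n a (ιV _ (Finsupp.single τ 1)) = der _ a τ := by
  induction a using TensorBosonization.induction with
  | hH φ => rw [tensorDuality_ιH]; simp
  | hV v => rw [tensorDuality_ιV, der_ιV, der_ιV, dot_single_right]
  | hmul a b ha hb =>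
    rw [tensorDuality_mul, comul_ιV, ydGroup_coact, map_add, TensorProduct.map_tmul,
      AlgHom.toLinearMap_apply, tensorPairing_tmul, tensorPairing_tmul, ha, hb, tensorDuality_of,
      (tensorDuality_isHopfPairing k n).one_right, der_mul, Finsupp.add_apply, ydFun_act,
      Finsupp.smul_apply, smul_eq_mul, add_comm, mul_comm (der _ a τ)]
  | hadd a b ha hb => simp only [map_add, LinearMap.add_apply, Finsupp.add_apply, ha, hb]

theorem mem_nicholsIdeal_ydFun (a : (ydFun k n).TensorBosonization) :
    a ∈ (ydFun k n).nicholsIdeal ↔ ∀ x, tensorDuality k n a x = 0 := by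
  refine mem_nicholsIdeal_iff _ _ (tensorDuality_isHopfPairing k n) (fun a => ⟨fun h => ?_,
    fun h z => ?_⟩) (fun a => ⟨fun h => ?_, fun h v => ?_⟩) a
  · exact FunctionAlgebra.ext fun g => by rw [← tensorDuality_of, h, map_zero]
  · induction z using MonoidAlgebra.induction_linear with
    | zero => simp
    | add z z' hz hz' => rw [map_add, map_add, hz, hz', add_zero]
    | single g c =>
      have hc : MonoidAlgebra.single g c = c • MonoidAlgebra.of k _ g := by simp
      rw [hc, map_smul, map_smul, tensorDuality_of, h, map_zero, smul_zero]
  · ext τ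
    rw [← tensorDuality_single, h, Finsupp.zero_apply]
  · induction v using Finsupp.induction_linear with
    | zero => simp
    | add z z' hz hz' => rw [map_add, map_add, hz, hz', add_zero]
    | single τ c =>
      have hc : Finsupp.single τ c = c • Finsupp.single τ (1 : k) := by simp
      rw [hc, map_smul, map_smul, tensorDuality_single, h, Finsupp.zero_apply, smul_zero]

theorem mem_nicholsIdeal_ydGroup (x : (ydGroup k n).TensorBosonization) :
    x ∈ (ydGroup k n).nicholsIdeal ↔ ∀ a, tensorDuality k n a x = 0 := by
  refine mem_nicholsIdeal_iff _ (ydFun k n) (tensorDuality_isHopfPairing k n).flip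
    (fun x => ⟨fun h => ?_, fun h φ => ?_⟩) (fun x => ⟨fun h => ?_, fun h v => ?_⟩) x
  · ext g
    have := h (δ k g)
    rwa [LinearMap.flip_apply, tensorDuality_ιH, evalPairing_δ] at this
  · rw [LinearMap.flip_apply, tensorDuality_ιH, h, map_zero]
  · ext τ
    have := h (Finsupp.single τ 1)
    rwa [LinearMap.flip_apply, tensorDuality_ιV, dot_single] at this
  · rw [LinearMap.flip_apply, tensorDuality_ιV, h, map_zero]

end Duality

open Coalgebra WithConv

/-! ### The twist of Sweedler's Hopf algebra and its transpose. -/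

section Sweedler

variable {k : Type u} [Field k] {A : Type v} [Ring A] [HopfAlgebra k A] {P Y χ : A}

/-- The twist of a quotient of Sweedler's Hopf algebra. -/
theorem isTwist_one_add_tmul (hPY : P * Y = 0) (hPP : P * P = 0) (hYY : Y * Y = 0)
    (hYP : Y * P = 0) (hΔP : comul (R := k) P = P ⊗ₜ[k] χ + 1 ⊗ₜ[k] P)
    (hΔY : comul (R := k) Y = Y ⊗ₜ[k] 1 + χ ⊗ₜ[k] Y) (hεP : counit (R := k) P = 0)
    (hεY : counit (R := k) Y = 0) : IsTwist (k := k) ((1 : A) ⊗ₜ[k] (1 : A) + P ⊗ₜ[k] Y) where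
  isUnit := by
    rw [← Algebra.TensorProduct.one_def]
    refine IsNilpotent.isUnit_one_add ⟨2, ?_⟩
    rw [pow_two, Algebra.TensorProduct.tmul_mul_tmul, hPP, TensorProduct.zero_tmul]
  twist := by
    -- Both sides reduce to 1 ⊗ 1 ⊗ 1 + 1 ⊗ P ⊗ Y + P ⊗ Y ⊗ 1 + P ⊗ χ ⊗ Y; every other term contains
    -- one of PY, P², Y², YP.
    simp only [map_add, LinearMap.lTensor_tmul, LinearMap.rTensor_tmul, hΔP, hΔY,
      Bialgebra.comul_one, Algebra.TensorProduct.one_def, TensorProduct.tmul_add,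
      TensorProduct.add_tmul, mul_add, add_mul, Algebra.TensorProduct.tmul_mul_tmul, one_mul,
      mul_one, hPY, hPP, hYY, hYP, TensorProduct.zero_tmul, TensorProduct.tmul_zero, add_zero,
      TensorProduct.assoc_tmul]
    abel
  id_counit := by simp [hεY]
  counit_id := by simp [hεP]

end Sweedler

section Pairing

variable {k : Type u} [Field k] {A : Type v} {A' : Type w} [Ring A] [HopfAlgebra k A] [Ring A']
  [HopfAlgebra k A'] {B : A →ₗ[k] A' →ₗ[k] k}

namespace IsHopfPairing

theorem tensorPairing_one (hB : IsHopfPairing B) : toConv (tensorPairing B 1) = 1 := by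
  apply WithConv.ext
  ext x y
  simp [Algebra.TensorProduct.one_def, tensorPairing_tmul, hB.one_left, LinearMap.convOne_def,
    mul_comm]

theorem isUnit_tensorPairing (hB : IsHopfPairing B) {J : A ⊗[k] A} (hJ : IsUnit J) :
    IsUnit (toConv (tensorPairing B J)) := by
  let φ : A ⊗[k] A →* WithConv (A' ⊗[k] A' →ₗ[k] k) :=
    { toFun := fun s => toConv (tensorPairing B s)
      map_one' := hB.tensorPairing_one
      map_mul' := tensorPairing_mul hB.mul_left }
  exact hJ.map φ

theorem tensorPairing_one_add_tmul (hB : IsHopfPairing B) (P Y : A) (x y : A') :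
    tensorPairing B ((1 : A) ⊗ₜ[k] (1 : A) + P ⊗ₜ[k] Y) (x ⊗ₜ[k] y) =
      counit (R := k) x * counit (R := k) y + B P x * B Y y := by
  rw [map_add, LinearMap.add_apply, tensorPairing_tmul, tensorPairing_tmul, hB.one_left,
    hB.one_left]

/-- The transpose of the twist of a quotient of Sweedler's Hopf algebra is a 2-cocycle. -/
theorem isHopfTwoCocycle (hB : IsHopfPairing B) {P Y χ : A} (hPY : P * Y = 0) (hPP : P * P = 0)
    (hYY : Y * Y = 0) (hYP : Y * P = 0) (hΔP : comul (R := k) P = P ⊗ₜ[k] χ + 1 ⊗ₜ[k] P)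
    (hΔY : comul (R := k) Y = Y ⊗ₜ[k] 1 + χ ⊗ₜ[k] Y) (hεP : counit (R := k) P = 0)
    (hεY : counit (R := k) Y = 0) :
    IsHopfTwoCocycle (tensorPairing B ((1 : A) ⊗ₜ[k] (1 : A) + P ⊗ₜ[k] Y)) where
  isUnit := hB.isUnit_tensorPairing
    (isTwist_one_add_tmul hPY hPP hYY hYP hΔP hΔY hεP hεY).isUnit
  cocycle x y z := by
    -- For fixed z, the form σ(xy, z) in x ⊗ y is pairing with ε(z) 1 + ⟨Y, z⟩ Δ(P); for fixed x,
    -- σ(x, yz) is pairing with ε(x) 1 + ⟨P, x⟩ Δ(Y). Convolving with σ on the left then amounts to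
    -- multiplying these elements by J.
    have e1 : tensorPairing B ((1 : A) ⊗ₜ[k] (1 : A) + P ⊗ₜ[k] Y) ∘ₗ
        (TensorProduct.mk k A' A').flip z ∘ₗ LinearMap.mul' k A' =
        tensorPairing B (counit (R := k) z • 1 + B Y z • (P ⊗ₜ[k] χ + 1 ⊗ₜ[k] P)) := by
      refine TensorProduct.ext' fun x y => ?_
      rw [← hΔP]
      simp only [LinearMap.comp_apply, LinearMap.flip_apply, TensorProduct.mk_apply,
        LinearMap.mul'_apply]
      rw [hB.tensorPairing_one_add_tmul, hB.mul_right, map_add, map_smul, map_smul,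
        Algebra.TensorProduct.one_def]
      simp [tensorPairing_tmul, hB.one_left, mul_comm]
    have e2 : tensorPairing B ((1 : A) ⊗ₜ[k] (1 : A) + P ⊗ₜ[k] Y) ∘ₗ
        TensorProduct.mk k A' A' x ∘ₗ LinearMap.mul' k A' =
        tensorPairing B (counit (R := k) x • 1 + B P x • (Y ⊗ₜ[k] 1 + χ ⊗ₜ[k] Y)) := by
      refine TensorProduct.ext' fun y z => ?_
      rw [← hΔY]
      simp only [LinearMap.comp_apply, TensorProduct.mk_apply, LinearMap.mul'_apply]
      rw [hB.tensorPairing_one_add_tmul, hB.mul_right, map_add, map_smul, map_smul,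
        Algebra.TensorProduct.one_def]
      simp [tensorPairing_tmul, hB.one_left]
    rw [e1, e2, ← tensorPairing_mul hB.mul_left, ← tensorPairing_mul hB.mul_left]
    simp only [Algebra.TensorProduct.one_def, mul_add, add_mul, mul_smul_comm,
      Algebra.TensorProduct.tmul_mul_tmul, one_mul, mul_one, ← mul_assoc, hPP, hYP, hPY, hYY,
      TensorProduct.zero_tmul, TensorProduct.tmul_zero, add_zero, map_add, map_smul,
      LinearMap.add_apply, LinearMap.smul_apply, tensorPairing_tmul, hB.one_left, smul_eq_mul]
    ring
  right_one x := by rw [hB.tensorPairing_one_add_tmul, hB.one_right Y, hεY]; simp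
  left_one x := by rw [hB.tensorPairing_one_add_tmul, hB.one_right P, hεP]; simp

end IsHopfPairing

end Pairing

/-! ### The elements Y and χ of FK_n # k^{S_n}, and the twist J_n. -/

section FominKirillov

open YDModule TensorBosonization FunctionAlgebra Transposition

variable (k : Type u) [Field k] (n : ℕ)

/-- The sign, as an element of `k^{S_n}`. -/
def signFun : FunctionAlgebra k (Equiv.Perm (Fin n)) :=
  ∑ ω : Equiv.Perm (Fin n), sgn k ω • δ k ω

@[simp] theorem eval_signFun (g : Equiv.Perm (Fin n)) : eval g (signFun k n) = sgn k g := by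
  simp [signFun, map_sum]

theorem sgn_mul_self (g : Equiv.Perm (Fin n)) : sgn k g * sgn k g = 1 := by
  rw [sgn, ← Int.cast_mul, ← Units.val_mul, Int.units_mul_self, Units.val_one, Int.cast_one]

theorem comul_signFun : comul (R := k) (signFun k n) = signFun k n ⊗ₜ[k] signFun k n := by
  rw [comul_apply]
  simp only [eval_signFun, sgn_mul]
  rw [signFun, TensorProduct.sum_tmul]
  simp only [TensorProduct.tmul_sum, TensorProduct.tmul_smul, TensorProduct.smul_tmul', smul_smul]
  exact Finset.sum_congr rfl fun g _ => Finset.sum_congr rfl fun h _ => by rw [mul_comm]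

theorem signFun_mul_self : signFun k n * signFun k n = 1 :=
  FunctionAlgebra.ext fun g => by simp [sgn_mul_self]

/-- The sum of the basis of `V`. -/
def sumSingle : Transposition n →₀ k := ∑ η, Finsupp.single η 1

theorem sumSingle_apply (τ : Transposition n) : sumSingle k n τ = 1 := by
  simp [sumSingle, Finsupp.finsetSum_apply, Finsupp.single_apply]

/-- A function acts on y_η by its value at η, and transpositions are odd. -/
theorem signFun_act_sumSingle : (ydFun k n).act (signFun k n) (sumSingle k n) = -sumSingle k n := by
  ext τ
  rw [ydFun_act, eval_signFun, Finsupp.neg_apply, sumSingle_apply, sgn, τ.2.sign_eq]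
  simp

/-- Conjugation by ω permutes the transpositions, so the V-component does not depend on ω and the
sign splits off. -/
theorem coact_sumSingle :
    (ydFun k n).coact (sumSingle k n) = signFun k n ⊗ₜ[k] sumSingle k n := by
  have e : ∀ ω : Equiv.Perm (Fin n), ∑ η, Finsupp.single (conj ω⁻¹ η) (1 : k) = sumSingle k n := by
    intro ω
    refine Fintype.sum_bijective (conj ω⁻¹) ?_ _ _ fun _ => rfl
    exact Function.bijective_iff_has_inverse.2 ⟨conj ω, fun η => by simp [conj_conj, conj_one],
      fun η => by simp [conj_conj, conj_one]⟩
  conv_lhs => rw [sumSingle]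
  simp only [map_sum, ydFun_coact]
  rw [Finset.sum_comm]
  simp only [← Finset.smul_sum, ← TensorProduct.tmul_sum, e]
  simp only [signFun, TensorProduct.sum_tmul, TensorProduct.smul_tmul']

/-- The element `∑ y_η` of `T(V) # k^{S_n}`. -/
def tensorY : (ydFun k n).TensorBosonization := ιV _ (sumSingle k n)

/-- The sign, as an element of `T(V) # k^{S_n}`. -/
def tensorχ : (ydFun k n).TensorBosonization := ιH _ (signFun k n)

theorem comul_tensorχ : comul (R := k) (tensorχ k n) = tensorχ k n ⊗ₜ[k] tensorχ k n := by
  rw [tensorχ, comul_ιH, comul_signFun]; rfl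

theorem comul_tensorY :
    comul (R := k) (tensorY k n) = tensorY k n ⊗ₜ[k] 1 + tensorχ k n ⊗ₜ[k] tensorY k n := by
  rw [tensorY, comul_ιV, coact_sumSingle]; rfl

theorem counit_tensorY : counit (R := k) (tensorY k n) = 0 := counit_ιV _ _

theorem tensorχ_mul_self : tensorχ k n * tensorχ k n = 1 := by
  rw [tensorχ, ← map_mul, signFun_mul_self, map_one]

theorem tensorχ_mul_tensorY : tensorχ k n * tensorY k n = -(tensorY k n * tensorχ k n) := by
  rw [tensorχ, tensorY, cross, comul_signFun, TensorProduct.map_tmul, LinearMap.mul'_apply,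
    LinearMap.comp_apply, LinearMap.flip_apply, AlgHom.toLinearMap_apply, signFun_act_sumSingle,
    map_neg, neg_mul, AlgHom.toLinearMap_apply]

/-- The cross terms (Yχ + χY) ⊗ Y cancel and χ² = 1, so Y² is primitive. The pairing of a primitive
element with a product vanishes once it vanishes on both factors, and Y² has no component in degrees
zero and one, where the generators live. So it lies in the radical. -/
theorem tensorY_mul_self_mem : tensorY k n * tensorY k n ∈ (ydFun k n).nicholsIdeal := by
  have hΔ : comul (R := k) (tensorY k n * tensorY k n) =
      (tensorY k n * tensorY k n) ⊗ₜ[k] 1 + 1 ⊗ₜ[k] (tensorY k n * tensorY k n) := by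
    rw [Bialgebra.comul_mul, comul_tensorY]
    simp only [mul_add, add_mul, Algebra.TensorProduct.tmul_mul_tmul, mul_one, one_mul,
      tensorχ_mul_self, tensorχ_mul_tensorY, TensorProduct.neg_tmul]
    abel
  rw [mem_nicholsIdeal_ydFun]
  have hB := tensorDuality_isHopfPairing k n
  have key : ∀ x y, tensorDuality k n (tensorY k n * tensorY k n) x = 0 →
      tensorDuality k n (tensorY k n * tensorY k n) y = 0 →
      tensorDuality k n (tensorY k n * tensorY k n) (x * y) = 0 := fun x y hx hy => by
    rw [hB.mul_right, hΔ, map_add, LinearMap.add_apply, tensorPairing_tmul, tensorPairing_tmul,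
      hx, hy, zero_mul, mul_zero, add_zero]
  intro x
  induction x using induction_ydGroup k with
  | one => rw [hB.one_right, Bialgebra.counit_mul, counit_tensorY, zero_mul]
  | hH g a ha =>
    refine key _ _ ?_ ha
    rw [tensorDuality_of]
    simp [tensorY]
  | hV τ a ha =>
    refine key _ _ ?_ ha
    rw [tensorDuality_single, der_mul, counit_tensorY]
    simp [tensorY]
  | hadd a b ha hb => rw [map_add, ha, hb, add_zero]
  | hsmul c a ha => rw [map_smul, ha, smul_zero]

/-- Pairing with a product unfolds to Δ followed by `der` and `projH`, which is `degreeOne`. Applied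
to Yχ, it shows that ⟨Yχ, ·⟩ sees only the component of degree one. -/
theorem tensorDuality_ιV_mul_ιH (v : Transposition n →₀ k)
    (φ : FunctionAlgebra k (Equiv.Perm (Fin n))) (x : (ydGroup k n).TensorBosonization) :
    tensorDuality k n (ιV _ v * ιH _ φ) x = LinearMap.mul' k k
      (TensorProduct.map (dot k n v) (evalPairing k φ) (degreeOne _ x)) := by
  rw [tensorDuality_mul, degreeOne, LinearMap.comp_apply, ← (ℛ k x).eq]
  simp [tensorPairing_tmul, tensorDuality_ιH, tensorDuality_ιV]

/-- The element `∑ y_η` of `FK_n # k^{S_n}`. -/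
def sumY : FKFun k n := Ideal.Quotient.mk _ (tensorY k n)

/-- The sign, as an element of `FK_n # k^{S_n}`. -/
def signχ : FKFun k n := Ideal.Quotient.mk _ (tensorχ k n)

theorem sumY_eq : sumY k n = ∑ η, y k η := by
  simp [sumY, tensorY, sumSingle, y, NicholsBosonization.ιV, map_sum]

theorem signχ_eq : signχ k n = ∑ ω, sgn k ω • delta k ω := by
  change NicholsBosonization.ιH (ydFun k n) (signFun k n) = _
  simp [signFun, map_sum, delta]

/-- Reindexing the sum over τ by conjugation makes the second tensor factor independent of ω; the
sums over η and ω then give Y and χ in the first factor. -/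
theorem J_eq : J k n = 1 ⊗ₜ[k] 1 + (sumY k n * signχ k n) ⊗ₜ[k] sumY k n := by
  have e : ∀ ω : Equiv.Perm (Fin n), ∑ τ, y k (conj ω⁻¹ τ) = sumY k n := by
    intro ω
    rw [sumY_eq]
    refine Fintype.sum_bijective (conj ω⁻¹) ?_ _ _ fun _ => rfl
    exact Function.bijective_iff_has_inverse.2 ⟨conj ω, fun η => by simp [conj_conj, conj_one],
      fun η => by simp [conj_conj, conj_one]⟩
  rw [J]
  congr 1
  simp only [← TensorProduct.tmul_sum, e, ← TensorProduct.sum_tmul, ← Finset.sum_mul,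
    TensorProduct.smul_tmul', ← sumY_eq, ← mul_smul_comm, ← Finset.mul_sum, ← signχ_eq]

theorem sumY_mul_self : sumY k n * sumY k n = 0 := by
  rw [sumY, ← map_mul]
  exact Ideal.Quotient.eq_zero_iff_mem.2 (tensorY_mul_self_mem k n)

theorem signχ_mul_sumY : signχ k n * sumY k n = -(sumY k n * signχ k n) := by
  rw [sumY, signχ, ← map_mul, tensorχ_mul_tensorY, map_neg, map_mul]

theorem signχ_mul_self : signχ k n * signχ k n = 1 := by
  rw [signχ, ← map_mul, tensorχ_mul_self, map_one]

theorem comul_signχ : comul (R := k) (signχ k n) = signχ k n ⊗ₜ[k] signχ k n := by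
  rw [signχ, Bialgebra.Quotient.comul_mk, comul_tensorχ]; rfl

theorem comul_sumY :
    comul (R := k) (sumY k n) = sumY k n ⊗ₜ[k] 1 + signχ k n ⊗ₜ[k] sumY k n := by
  rw [sumY, Bialgebra.Quotient.comul_mk, comul_tensorY, map_add]; rfl

theorem counit_sumY : counit (R := k) (sumY k n) = 0 := counit_tensorY k n

theorem counit_sumY_mul_signχ : counit (R := k) (sumY k n * signχ k n) = 0 := by
  rw [Bialgebra.counit_mul, counit_sumY, zero_mul]

/-- Multiplying χ ⊗ Y by χ ⊗ χ gives 1 ⊗ Yχ, so Yχ is skew-primitive with 1 and χ in the positions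
opposite to those for Y. -/
theorem comul_sumY_mul_signχ : comul (R := k) (sumY k n * signχ k n) =
    (sumY k n * signχ k n) ⊗ₜ[k] signχ k n + 1 ⊗ₜ[k] (sumY k n * signχ k n) := by
  rw [Bialgebra.comul_mul, comul_sumY, comul_signχ, add_mul,
    Algebra.TensorProduct.tmul_mul_tmul, Algebra.TensorProduct.tmul_mul_tmul, signχ_mul_self,
    one_mul]

theorem sumY_mul_sumY_mul_signχ : sumY k n * (sumY k n * signχ k n) = 0 := by
  rw [← mul_assoc, sumY_mul_self, zero_mul]

theorem sumY_mul_signχ_mul_sumY : sumY k n * signχ k n * sumY k n = 0 := by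
  rw [mul_assoc, signχ_mul_sumY, mul_neg, sumY_mul_sumY_mul_signχ, neg_zero]

theorem sumY_mul_signχ_mul_self : sumY k n * signχ k n * (sumY k n * signχ k n) = 0 := by
  rw [← mul_assoc, sumY_mul_signχ_mul_sumY, zero_mul]

theorem isTwist_J : IsTwist (J k n) := by
  rw [J_eq]
  exact isTwist_one_add_tmul (sumY_mul_signχ_mul_sumY k n) (sumY_mul_signχ_mul_self k n)
    (sumY_mul_self k n) (sumY_mul_sumY_mul_signχ k n) (comul_sumY_mul_signχ k n) (comul_sumY k n)
    (counit_sumY_mul_signχ k n) (counit_sumY k n)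

theorem isHopfTwoCocycle_tensorPairing_J {B : FKFun k n →ₗ[k] FKGroup k n →ₗ[k] k}
    (hB : IsHopfPairing B) : IsHopfTwoCocycle (tensorPairing B (J k n)) := by
  rw [J_eq]
  exact hB.isHopfTwoCocycle (sumY_mul_signχ_mul_sumY k n) (sumY_mul_signχ_mul_self k n)
    (sumY_mul_self k n) (sumY_mul_sumY_mul_signχ k n) (comul_sumY_mul_signχ k n) (comul_sumY k n)
    (counit_sumY_mul_signχ k n) (counit_sumY k n)

end FominKirillov

/-! ### Uniqueness of the cocycle and of the duality, and their values. -/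

open Coalgebra WithConv YDModule TensorBosonization FunctionAlgebra Transposition

namespace YDModule.NicholsBosonization

variable {k : Type u} {H : Type v} {V : Type w} [Field k] [Ring H] [HopfAlgebra k H]
    [AddCommGroup V] [Module k V] (M : YDModule k H V)

theorem component_eq_map (m : ℕ) : component M m =
    (M.tensorComponent m).map (Ideal.Quotient.mkₐ k M.nicholsIdeal).toLinearMap := by
  rw [component, tensorComponent, Submodule.map_mul, Submodule.map_pow, ← LinearMap.range_comp,
    ← LinearMap.range_comp]
  rfl

theorem iSup_component : ⨆ m, component M m = ⊤ := by
  simp only [component_eq_map]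
  rw [← Submodule.map_iSup, iSup_tensorComponent, Submodule.map_top, LinearMap.range_eq_top]
  exact Ideal.Quotient.mk_surjective

end YDModule.NicholsBosonization

variable (k : Type u) [Field k] (n : ℕ)

theorem component_zero_eq_span : NicholsBosonization.component (ydGroup k n) 0 =
    Submodule.span k (Set.range (grp k)) := by
  rw [NicholsBosonization.component, pow_zero, one_mul, ← Submodule.map_top,
    ← span_of k, Submodule.map_span, ← Set.range_comp]
  rfl

open scoped Pointwise in
theorem component_one_eq_span : NicholsBosonization.component (ydGroup k n) 1 =
    Submodule.span k (Set.range (x k (n := n)) * Set.range (grp k (n := n))) := by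
  rw [← Submodule.span_mul_span, ← component_zero_eq_span, NicholsBosonization.component,
    NicholsBosonization.component, pow_zero, one_mul, pow_one]
  congr 1
  rw [← Submodule.map_top, ← span_single k, Submodule.map_span, ← Set.range_comp]
  rfl

variable {k n}

/-- The values of the cocycle determine it. -/
theorem IsGarciaMastnak.unique {σ σ' : FKGroup k n ⊗[k] FKGroup k n →ₗ[k] k}
    (h : IsGarciaMastnak σ) (h' : IsGarciaMastnak σ') : σ' = σ := by
  have span : ∀ S : Set (FKGroup k n), (∀ a ∈ S, ∀ b ∈ S, σ' (a ⊗ₜ[k] b) = σ (a ⊗ₜ[k] b)) →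
      ∀ a ∈ Submodule.span k S, ∀ b ∈ Submodule.span k S,
        σ' (a ⊗ₜ[k] b) = σ (a ⊗ₜ[k] b) := by
    intro S hS a ha b hb
    induction ha using Submodule.span_induction with
    | mem a ha =>
      induction hb using Submodule.span_induction with
      | mem b hb => exact hS a ha b hb
      | zero => simp
      | add b b' _ _ i i' => simp only [TensorProduct.tmul_add, map_add, i, i']
      | smul c b _ i => simp only [TensorProduct.tmul_smul, map_smul, i]
    | zero => simp
    | add b b' _ _ i i' => simp only [TensorProduct.add_tmul, map_add, i, i']
    | smul c b _ i => simp only [← TensorProduct.smul_tmul', map_smul, i]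
  have key : ∀ i j, ∀ a ∈ NicholsBosonization.component (ydGroup k n) i,
      ∀ b ∈ NicholsBosonization.component (ydGroup k n) j,
      σ' (a ⊗ₜ[k] b) = σ (a ⊗ₜ[k] b) := by
    intro i j a ha b hb
    by_cases h0 : (i, j) = (0, 0)
    · obtain ⟨rfl, rfl⟩ := Prod.mk.inj h0
      rw [component_zero_eq_span] at ha hb
      refine span _ ?_ a ha b hb
      rintro _ ⟨g, rfl⟩ _ ⟨g', rfl⟩
      rw [h.zero_zero, h'.zero_zero]
    · by_cases h1 : (i, j) = (1, 1)
      · obtain ⟨rfl, rfl⟩ := Prod.mk.inj h1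
        rw [component_one_eq_span] at ha hb
        refine span _ ?_ a ha b hb
        rintro _ ⟨_, ⟨τ, rfl⟩, _, ⟨g, rfl⟩, rfl⟩ _ ⟨_, ⟨τ', rfl⟩, _, ⟨g', rfl⟩, rfl⟩
        exact (h'.one_one τ τ' g g').trans (h.one_one τ τ' g g').symm
      · rw [h.elsewhere i j h0 h1 a ha b hb, h'.elsewhere i j h0 h1 a ha b hb]
  have mem : ∀ a : FKGroup k n, a ∈ ⨆ m, NicholsBosonization.component (ydGroup k n) m :=
    fun a => by rw [NicholsBosonization.iSup_component]; trivial
  refine TensorProduct.ext' fun a b => ?_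
  induction mem a using Submodule.iSup_induction' with
  | mem i a ha =>
    induction mem b using Submodule.iSup_induction' with
    | mem j b hb => exact key i j a ha b hb
    | zero => simp
    | add b b' _ _ i i' => simp only [TensorProduct.tmul_add, map_add, i, i']
  | zero => simp
  | add b b' _ _ i i' => simp only [TensorProduct.add_tmul, map_add, i, i']

/-- The values on the generators determine the duality. -/
theorem IsDuality.unique {B B' : FKFun k n →ₗ[k] FKGroup k n →ₗ[k] k} (h : IsDuality B)
    (h' : IsDuality B') : B' = B := by
  have left : ∀ (t : FKFun k n ⊗[k] FKFun k n) (x y : FKGroup k n), (∀ a, B' a x = B a x) →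
      (∀ a, B' a y = B a y) → tensorPairing B' t (x ⊗ₜ[k] y) = tensorPairing B t (x ⊗ₜ[k] y) := by
    intro t x y hx hy
    induction t using TensorProduct.induction_on with
    | zero => simp
    | add s s' hs hs' => simp only [map_add, LinearMap.add_apply, hs, hs']
    | tmul a b => rw [tensorPairing_tmul, tensorPairing_tmul, hx, hy]
  have gen : ∀ C : FKFun k n → Prop, (∀ ω, C (delta k ω)) → (∀ η, C (y k η)) →
      (∀ a b, C a → C b → C (a * b)) → (∀ a b, C a → C b → C (a + b)) →
      (∀ (c : k) a, C a → C (c • a)) → ∀ a, C a := by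
    intro C hδ hy hmul hadd hsmul a
    have zero : C 0 := by simpa using hsmul 0 _ (hδ 1)
    obtain ⟨a, rfl⟩ := Ideal.Quotient.mk_surjective a
    induction a using TensorBosonization.induction with
    | hH φ =>
      change C (NicholsBosonization.ιH (ydFun k n) φ)
      rw [← sum_eval φ, map_sum]
      simp only [map_smul]
      exact Finset.sum_induction _ C hadd zero fun ω _ => hsmul _ _ (hδ ω)
    | hV v =>
      change C (NicholsBosonization.ιV (ydFun k n) v)
      induction v using Finsupp.induction_linear with
      | zero => rwa [map_zero]
      | add v w hv hw => rw [map_add]; exact hadd _ _ hv hw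
      | single η c =>
        have := hsmul c _ (hy η)
        rwa [y, ← map_smul, Finsupp.smul_single, smul_eq_mul, mul_one] at this
    | hmul a b ha hb => rw [map_mul]; exact hmul _ _ ha hb
    | hadd a b ha hb => rw [map_add]; exact hadd _ _ ha hb
  -- Since g is grouplike, multiplicativity in the first argument determines ⟨·, g⟩ from the δ_ω and
  -- y_η. The coproduct of x_τ involves only x_τ, 1 and τ, so ⟨·, x_τ⟩ is determined next.
  -- Multiplicativity in the second argument then reaches every z.
  have hgrp : ∀ g a, B' a (grp k g) = B a (grp k g) := by
    intro g
    have hΔ : comul (R := k) (grp k g) = grp k g ⊗ₜ[k] grp k g := by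
      change TensorProduct.map _ _ (comul (R := k) (ιH (ydGroup k n) (MonoidAlgebra.of k _ g))) = _
      rw [comul_ιH]
      simp
      rfl
    refine gen _ (fun ω => ?_) (fun η => ?_) (fun a b ha hb => ?_) (fun a b ha hb => ?_)
      (fun c a ha => ?_)
    · rw [h.delta_grp, h'.delta_grp]
    · rw [h.y_grp, h'.y_grp]
    · rw [h.mul_left, h'.mul_left, hΔ, tensorPairing_tmul, tensorPairing_tmul, ha, hb]
    · rw [map_add, map_add, LinearMap.add_apply, LinearMap.add_apply, ha, hb]
    · rw [map_smul, map_smul, LinearMap.smul_apply, LinearMap.smul_apply, ha]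
  have hx : ∀ τ a, B' a (x k τ) = B a (x k τ) := by
    intro τ
    have hΔ : comul (R := k) (x k τ) = x k τ ⊗ₜ[k] 1 + grp k τ.1 ⊗ₜ[k] x k τ := by
      change TensorProduct.map _ _ (comul (R := k) (ιV (ydGroup k n) (Finsupp.single τ 1))) = _
      rw [comul_ιV, ydGroup_coact, map_add]
      rfl
    refine gen _ (fun ω => ?_) (fun η => ?_) (fun a b ha hb => ?_) (fun a b ha hb => ?_)
      (fun c a ha => ?_)
    · rw [h.delta_x, h'.delta_x]
    · rw [h.y_x, h'.y_x]
    · rw [h.mul_left, h'.mul_left, hΔ, map_add, map_add]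
      simp only [tensorPairing_tmul, ha, hb, hgrp, h.one_right, h'.one_right]
    · rw [map_add, map_add, LinearMap.add_apply, LinearMap.add_apply, ha, hb]
    · rw [map_smul, map_smul, LinearMap.smul_apply, LinearMap.smul_apply, ha]
  refine LinearMap.ext fun a => LinearMap.ext fun z => ?_
  obtain ⟨z, rfl⟩ := Ideal.Quotient.mk_surjective z
  induction z using induction_ydGroup k generalizing a with
  | one => rw [map_one, h.one_right, h'.one_right]
  | hH g z hz =>
    rw [map_mul, h.mul_right, h'.mul_right]
    exact left _ _ _ (hgrp g) hz
  | hV τ z hz =>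
    rw [map_mul, h.mul_right, h'.mul_right]
    exact left _ _ _ (hx τ) hz
  | hadd z z' hz hz' => rw [map_add, map_add, map_add, hz, hz']
  | hsmul c z hz =>
    have e : Ideal.Quotient.mk (ydGroup k n).nicholsIdeal (c • z) =
      c • Ideal.Quotient.mk (ydGroup k n).nicholsIdeal z := rfl
    rw [e, map_smul, map_smul, hz]

variable {B : FKFun k n →ₗ[k] FKGroup k n →ₗ[k] k}

theorem isDuality_of_mk (hB : IsHopfPairing B) (h : ∀ a x, B (Ideal.Quotient.mk _ a)
    (Ideal.Quotient.mk _ x) = tensorDuality k n a x) : IsDuality B where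
  toIsHopfPairing := hB
  delta_grp ω g := by
    refine (h (ιH _ (δ k ω)) (ιH _ (MonoidAlgebra.of k _ g))).trans ?_
    rw [tensorDuality_of, projH_ιH, eval_δ]
    simp only [eq_comm]
  y_x η τ := by
    refine (h (ιV _ (Finsupp.single η 1)) (ιV _ (Finsupp.single τ 1))).trans ?_
    rw [tensorDuality_single, der_ιV, Finsupp.single_apply]
  delta_x ω τ := by
    refine (h (ιH _ (δ k ω)) (ιV _ (Finsupp.single τ 1))).trans ?_
    rw [tensorDuality_single, der_ιH, Finsupp.zero_apply]
  y_grp η g := by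
    refine (h (ιV _ (Finsupp.single η 1)) (ιH _ (MonoidAlgebra.of k _ g))).trans ?_
    rw [tensorDuality_of, projH_ιV, map_zero]

/-- The form is ε(x)ε(x') + ⟨Yχ, x⟩⟨Y, x'⟩. Counits vanish in nonzero degree, and ⟨Y, ·⟩ and ⟨Yχ, ·⟩
vanish outside degree one. On x_τ ω they take the values 1 and sgn(ω). -/
theorem isGarciaMastnak_of_mk (hB : IsHopfPairing B) (h : ∀ a x, B (Ideal.Quotient.mk _ a)
    (Ideal.Quotient.mk _ x) = tensorDuality k n a x) :
    IsGarciaMastnak (tensorPairing B (J k n)) := by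
  have hY : ∀ x, B (sumY k n) (Ideal.Quotient.mk _ x) = dot k n (sumSingle k n) (der _ x) :=
    fun x => (h _ _).trans (tensorDuality_ιV k n _ x)
  have hYχ : ∀ x, B (sumY k n * signχ k n) (Ideal.Quotient.mk _ x) = LinearMap.mul' k k
      (TensorProduct.map (dot k n (sumSingle k n)) (evalPairing k (signFun k n))
        (degreeOne _ x)) :=
    fun x => (h _ _).trans (tensorDuality_ιV_mul_ιH k n _ _ x)
  have hdeg : ∀ i ≠ 1, ∀ x ∈ (ydGroup k n).tensorComponent i,
      der _ x = 0 ∧ degreeOne _ x = 0 := by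
    intro i hi x hx
    match i with
    | 0 =>
      rw [tensorComponent_zero] at hx
      obtain ⟨z, rfl⟩ := hx
      simp
    | 1 => exact absurd rfl hi
    | m + 2 =>
      exact (degreeTwo_vanish _ (le_iSup₂_of_le (f := fun (m : ℕ) (_ : 2 ≤ m) =>
        (ydGroup k n).tensorComponent m) (m + 2) (by omega) le_rfl hx)).2
  have hε : ∀ i ≠ 0, ∀ x ∈ (ydGroup k n).tensorComponent i, counit (R := k) x = 0 := by
    intro i hi x hx
    obtain ⟨m, rfl⟩ := Nat.exists_eq_succ_of_ne_zero hi
    rw [counit_eq_counit_projH, projH_eq_zero _ hx, map_zero]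
  refine ⟨fun τ τ' ω ω' => ?_, fun ω ω' => ?_, fun i j h0 h1 a ha b hb => ?_⟩
  · rw [J_eq, hB.tensorPairing_one_add_tmul]
    have e : ∀ (τ : Transposition n) (ω : Equiv.Perm (Fin n)), x k τ * grp k ω =
      Ideal.Quotient.mk _ (ιV (ydGroup k n) (Finsupp.single τ 1) *
        ιH _ (MonoidAlgebra.of k _ ω)) := fun τ ω => rfl
    have e' : counit (R := k) (x k τ) = 0 := counit_ιV (ydGroup k n) (Finsupp.single τ 1)
    rw [Bialgebra.counit_mul, e', e, e, hY, hYχ, degreeOne_ιV_mul, der_mul]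
    simp [dot_single_right, sumSingle_apply]
  · have e : ∀ ω : Equiv.Perm (Fin n), counit (R := k) (grp k ω) = 1 := fun ω =>
      (counit_ιH (ydGroup k n) (MonoidAlgebra.of k _ ω)).trans (by simp)
    have e' : B (sumY k n) (grp k ω') = 0 := (hY (ιH _ (MonoidAlgebra.of k _ ω'))).trans (by simp)
    rw [J_eq, hB.tensorPairing_one_add_tmul, e, e, e']
    simp
  · rw [NicholsBosonization.component_eq_map] at ha hb
    obtain ⟨a, ha, rfl⟩ := ha
    obtain ⟨b, hb, rfl⟩ := hb
    change tensorPairing B (J k n) (Ideal.Quotient.mk _ a ⊗ₜ[k] Ideal.Quotient.mk _ b) = 0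
    rw [J_eq, hB.tensorPairing_one_add_tmul, hY, hYχ, Bialgebra.Quotient.counit_mk,
      Bialgebra.Quotient.counit_mk]
    have z1 : counit (R := k) a * counit (R := k) b = 0 := by
      by_cases hi : i = 0
      · have hj : j ≠ 0 := fun hj => h0 (by rw [hi, hj])
        rw [hε j hj b hb, mul_zero]
      · rw [hε i hi a ha, zero_mul]
    rw [z1, zero_add]
    by_cases hi : i = 1
    · have hj : j ≠ 1 := fun hj => h1 (by rw [hi, hj])
      rw [(hdeg j hj b hb).1, map_zero, mul_zero]
    · rw [(hdeg i hi a ha).2, map_zero, map_zero, zero_mul]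

end

end FKTwist

theorem mainTheorem6 (k : Type*) [Field k] [IsAlgClosed k] [CharZero k] (n : ℕ)
    (hn : n = 3 ∨ n = 4) :
    FKTwist.IsTwist (FKTwist.J k n) ∧
    ∃ σ : FKTwist.FKGroup k n ⊗[k] FKTwist.FKGroup k n →ₗ[k] k,
      (FKTwist.IsGarciaMastnak σ ∧ ∀ σ', FKTwist.IsGarciaMastnak σ' → σ' = σ) ∧
      FKTwist.IsHopfTwoCocycle σ ∧
      ∃ B : FKTwist.FKFun k n →ₗ[k] FKTwist.FKGroup k n →ₗ[k] k,
        (FKTwist.IsDuality B ∧ ∀ B', FKTwist.IsDuality B' → B' = B) ∧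
        (∀ a, (∀ x, B a x = 0) → a = 0) ∧ (∀ x, (∀ a, B a x = 0) → x = 0) ∧
        ∀ x x', σ (x ⊗ₜ[k] x') =
          FKTwist.tensorPairing B (FKTwist.J k n) (x ⊗ₜ[k] x') := by
  -- The two Nichols ideals are exactly the radicals of the pairing of the tensor bosonizations, so
  -- it descends to a pairing nondegenerate on both sides.
  obtain ⟨B, hB, hmk, hl, hr⟩ := (FKTwist.tensorDuality_isHopfPairing k n).exists_quotient
    (FKTwist.ydFun k n).nicholsIdeal (FKTwist.ydGroup k n).nicholsIdeal
    (FKTwist.mem_nicholsIdeal_ydFun k n) (FKTwist.mem_nicholsIdeal_ydGroup k n)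
  have hσ := FKTwist.isGarciaMastnak_of_mk hB hmk
  have hD := FKTwist.isDuality_of_mk hB hmk
  exact ⟨FKTwist.isTwist_J k n, FKTwist.tensorPairing B (FKTwist.J k n),
    ⟨hσ, fun σ' hσ' => hσ.unique hσ'⟩, FKTwist.isHopfTwoCocycle_tensorPairing_J k n hB,
    B, ⟨hD, fun B' hB' => hD.unique hB'⟩, hl, hr, fun _ _ => rfl⟩
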